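/- **Theorem (Post-selection multinomial logistic regression).** Let $\{(x_i,d_i)\}_{i=1}^n$ be i.i.d. copies of $(X,D)$ with $D\in\{0,1,\dots,T\}$, $T\ge 1$; let $p_t(x)=\mathbb P[D=t\mid X=x]$ and suppose $p_t(X)\ge p_{\min}>0$ almost surely for $t=0,\dots,T$. Let $x_i^*\in\mathbb R^p$ be a fixed measurable transformation of $x_i$ with $\max_j|x^*_{i,j}|\le\mathcal X$ almost surely. Write $\mathbb E_n[w_i]=\frac1n\sum_{i}w_i$ and $Q=\mathbb E_n[x_i^*x_i^{*\prime}]$. For $m\in\mathbb R^T$ let $\hat p_t(m)=e^{m_t}/(1+\sum_{r=1}^T e^{m_r})$, $1\le t\le T$, and $\hat p_0(m)=1-\sum_{t\ge1}\hat p_t(m)$. For $\gamma=(\gamma_{t,j})\in\mathbb R^{T\times p}$ let $$\mathcal M(\gamma)=\sum_{t=0}^T\mathbb E_n\big[-\mathbf 1\{d_i=t\}\log\hat p_t(\{x_i^{*\prime}\gamma_r\}_{r=1}^T)\big],\qquad |||\gamma|||=\sum_{j=1}^p\|\gamma_{\cdot,j}\|_2 ,$$ and $\operatorname{supp}\gamma=\{j:\gamma_{\cdot,j}\ne0\}$.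 Fix $\gamma^*\in\mathbb R^{T\times p}$ with $S_*=\operatorname{supp}\gamma^*$ and $s=|S_*|<n$. Fix $\delta>0$ and put $$\lambda=\frac{2\mathcal X\sqrt T}{\sqrt n}\Big(1+\frac{\log(p\vee n)^{3/2+\delta}}{\sqrt T}\Big)^{1/2},\qquad \mathcal P=\frac{4\sqrt{\log(2p)(1+64\log(12p)^2)}}{\log(p\vee n)^{3/2+\delta}} .$$ Let $\tilde\gamma$ minimize $\mathcal M(\gamma)+\lambda|||\gamma|||$ over $\gamma$, let $\hat S\supseteq\operatorname{supp}\tilde\gamma$ be any (possibly data-dependent) set with $|\hat S|\le s$, and let $\hat\gamma$ minimize $\mathcal M(\gamma)$ over $\operatorname{supp}\gamma\subseteq\hat S$. Let $S_D=\hat S\cup S_*$ and $\underline\phi=\big(\min\{\delta'Q\delta/\|\delta\|_2^2:\ 0\ne\delta\in\mathbb R^p,\ \delta_j=0\text{ for }j\notin S_D\}\big)^{1/2}$. The quantities $b,\kappa,A_K$ below may depend on the sample. Consider the following conditions on the sample: 1. (bias) $\mathbb E_n[(\hat p_t(\{x_i^{*\prime}\gamma^*_r\}_r)-p_t(x_i))^2]^{1/2}\le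 b$ for $1\le t\le T$, and $b<p_{\min}$; 2. (eigenvalues) $\underline\phi>0$, $\kappa>0$ and $\kappa^2\le\sum_{t=1}^T\delta_t'Q\delta_t\big/\|\delta_{\cdot,S_*}\|_2^2$ for every $\delta\in\mathbb R^{T\times p}\setminus\{0\}$ with $|||\delta_{\cdot,S_*^c}|||\le4|||\delta_{\cdot,S_*}|||$; 3. (choice of $A_K$) with $A_p=p_{\min}/(p_{\min}-b)$ and $$R_{\mathcal M}=\Big(\frac{A_p}{p_{\min}}\Big)^{T+1}TA_K\Big(6\frac{\lambda\sqrt s}{\kappa}+8b\sqrt T\Big),$$ the three denominators below are positive and $$A_K>\frac{2\kappa^2}{\kappa^2-\frac23\mathcal X\sqrt T\big(30\lambda s+100\sqrt s\,\kappa b\sqrt T+80\kappa^2b^2T\lambda^{-1}\big)},$$ $$A_K>\frac{2\underline\phi^2}{\underline\phi^2-\mathcal X\sqrt T\big(\lambda|S_D|+b\underline\phi\sqrt T\sqrt{|S_D|}\big)}\ \vee\ \frac{\underline\phi}{\underline\phi-2R_{\mathcal M}\mathcal X\sqrt T\sqrt{|S_D|}} .$$ Define $R_{\mathcal M}'=(A_p/p_{\min})^{T+1}TA_K\big(\lambda\sqrt{|S_D|}\,\underline\phi^{-1}/2+b\sqrt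 T\big)$ and $$R_{\mathcal M}''=R_{\mathcal M}\vee\Big\{R_{\mathcal M}'+\Big[R_{\mathcal M}'R_{\mathcal M}+\Big(\frac{A_p}{p_{\min}}\Big)^{T+1}TA_KR_{\mathcal M}^2\Big]^{1/2}\Big\}.$$ Then, except on an event of probability at most $\mathcal P$, whenever conditions 1–3 hold and the minimizers $\tilde\gamma,\hat\gamma$ exist, $$\max_{1\le t\le T}\mathbb E_n\big[(\hat p_t(\{x_i^{*\prime}\hat\gamma_r\}_r)-p_t(x_i))^2\big]^{1/2}\le R_{\mathcal M}''+b \quad\text{and}\quad \max_{1\le t\le T}\|\hat\gamma_t-\gamma_t^*\|_1\le\frac{\sqrt{|S_D|}}{\underline\phi}\,R_{\mathcal M}'' .$$ -/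

import Mathlib

open MeasureTheory ProbabilityTheory

noncomputable section

namespace PostMLogit

/-! Treatments are `Fin (T + 1)`: `0` is the baseline and `t.succ`, for `t : Fin T`, runs over the
nonbaseline treatments `1, …, T`. -/

/-- Coefficients `γ t j`, one vector of length `p` for each nonbaseline treatment `t`. -/
abbrev Coef (T p : ℕ) : Type := Fin T → Fin p → ℝ

/-- The empirical expectation `𝔼ₙ[w i] = (∑ i, w i) / n`. -/
def empMean {n : ℕ} (w : Fin n → ℝ) : ℝ := (∑ i, w i) / n

/-- The multinomial logit function: `exp (m t) / (1 + ∑ s, exp (m s))` for a nonbaseline treatment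
`t`, and `1 / (1 + ∑ s, exp (m s))` for the baseline. -/
def mlogit {T : ℕ} (m : Fin T → ℝ) (t : Fin (T + 1)) : ℝ :=
  (Fin.cons 1 (fun s => Real.exp (m s)) : Fin (T + 1) → ℝ) t / (1 + ∑ s, Real.exp (m s))

/-- The linear indices `(xᵢ' γ t)` over `t`, for observation `i`. -/
def index {n p T : ℕ} (x : Fin n → Fin p → ℝ) (γ : Coef T p) (i : Fin n) (t : Fin T) : ℝ :=
  ∑ j, x i j * γ t j

/-- The multinomial logistic loss `ℳ(γ)`: the average negative log-likelihood. -/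
def loss {n p T : ℕ} (x : Fin n → Fin p → ℝ) (d : Fin n → Fin (T + 1)) (γ : Coef T p) : ℝ :=
  ∑ t : Fin (T + 1),
    empMean fun i => -(if d i = t then (1 : ℝ) else 0) * Real.log (mlogit (index x γ i) t)

/-- The part over `j ∈ S` of the mixed `ℓ₂/ℓ₁` norm: `∑ j ∈ S, ‖δ_{·,j}‖₂`. -/
def groupNormOn {p T : ℕ} (S : Finset (Fin p)) (δ : Coef T p) : ℝ :=
  ∑ j ∈ S, √(∑ t, δ t j ^ 2)

/-- The mixed `ℓ₂/ℓ₁` norm: `∑ j, ‖δ_{·,j}‖₂`. -/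
def groupNorm {p T : ℕ} (δ : Coef T p) : ℝ := groupNormOn Finset.univ δ

open Classical in
/-- The set of covariates `j` whose coefficient is nonzero for some treatment. -/
def groupSupport {p T : ℕ} (γ : Coef T p) : Finset (Fin p) :=
  Finset.univ.filter fun j => ∃ t, γ t j ≠ 0

/-- `γ` is a group lasso estimate with penalty parameter `lam`. -/
def IsGroupLasso {n p T : ℕ} (x : Fin n → Fin p → ℝ) (d : Fin n → Fin (T + 1)) (lam : ℝ)
    (γ : Coef T p) : Prop :=
  ∀ γ' : Coef T p, loss x d γ + lam * groupNorm γ ≤ loss x d γ' + lam * groupNorm γ'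

/-- `γ` is an unpenalized multinomial logit estimate that uses only the covariates in `S`. -/
def IsRefit {n p T : ℕ} (x : Fin n → Fin p → ℝ) (d : Fin n → Fin (T + 1)) (S : Finset (Fin p))
    (γ : Coef T p) : Prop :=
  groupSupport γ ⊆ S ∧ ∀ γ' : Coef T p, groupSupport γ' ⊆ S → loss x d γ ≤ loss x d γ'

/-- The empirical Gram matrix `Q = 𝔼ₙ[xᵢ xᵢ']`. -/
def gram {n p : ℕ} (x : Fin n → Fin p → ℝ) : Matrix (Fin p) (Fin p) ℝ :=
  Matrix.of fun j k => empMean fun i => x i j * x i k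

/-- The quadratic form `δ' Q δ`. -/
def quadForm {p : ℕ} (Q : Matrix (Fin p) (Fin p) ℝ) (δ : Fin p → ℝ) : ℝ := δ ⬝ᵥ Q.mulVec δ

/-- The minimal sparse eigenvalue `φ{Q, S}`, on the square root scale: its square is the minimum of
`δ' Q δ / ‖δ‖₂²` over the nonzero vectors supported in `S`. -/
def sparseEigMin {p : ℕ} (Q : Matrix (Fin p) (Fin p) ℝ) (S : Finset (Fin p)) : ℝ :=
  √(sInf {r : ℝ | ∃ δ : Fin p → ℝ, δ ≠ 0 ∧ (∀ j, j ∉ S → δ j = 0) ∧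
    r = quadForm Q δ / ∑ j, δ j ^ 2})

/-- `κ²` is a lower bound for the minimal restricted eigenvalue of `Q` over the cone
`⦀δ_{·,Sᶜ}⦀ ≤ 4 ⦀δ_{·,S}⦀`. -/
def IsRestrictedEigBound {p : ℕ} (T : ℕ) (Q : Matrix (Fin p) (Fin p) ℝ) (S : Finset (Fin p))
    (κ : ℝ) : Prop :=
  ∀ δ : Coef T p, δ ≠ 0 → groupNormOn Sᶜ δ ≤ 4 * groupNormOn S δ →
    κ ^ 2 ≤ (∑ t, quadForm Q (δ t)) / ∑ t, ∑ j ∈ S, δ t j ^ 2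

/-- The prediction error `𝔼ₙ[(p̂_t(xᵢ'γ) - p_t(xᵢ))²]^{1/2}`, where `pr i t = p_t(xᵢ)`. -/
def propError {n p T : ℕ} (x : Fin n → Fin p → ℝ) (pr : Fin n → Fin (T + 1) → ℝ) (γ : Coef T p)
    (t : Fin (T + 1)) : ℝ :=
  √(empMean fun i => (mlogit (index x γ i) t - pr i t) ^ 2)

/-- The penalty parameter `λ_D`. -/
def penalty (n p T : ℕ) (X δD : ℝ) : ℝ :=
  2 * X * √T / √n * √(1 + Real.log (max p n : ℕ) ^ (3 / 2 + δD) / √T)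

/-- The probability `𝒫`. -/
def excProb (n p : ℕ) (δD : ℝ) : ℝ :=
  4 * √(Real.log (2 * p) * (1 + 64 * Real.log (12 * p) ^ 2)) /
    Real.log (max p n : ℕ) ^ (3 / 2 + δD)

/-- `A_p = p_min / (0 ∨ (p_min - b))`. -/
def Ap (pmin b : ℝ) : ℝ := pmin / max 0 (pmin - b)

/-- The group lasso rate `R_ℳ`; `s` is the number of relevant covariates. -/
def RM (T s : ℕ) (lam pmin b κ A : ℝ) : ℝ :=
  (Ap pmin b / pmin) ^ (T + 1) * T * A * (6 * (lam * √s / κ) + 8 * b * √T)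

/-- The denominator in the lower bound on `A_K` for the group lasso. -/
def lassoDen (T s : ℕ) (X lam b κ : ℝ) : ℝ :=
  κ ^ 2 - 2 / 3 * X * √T *
    (30 * lam * s + 100 * √s * κ * b * √T + 80 * κ ^ 2 * b ^ 2 * T * lam⁻¹)

/-- The denominator in the first lower bound on `A_K` for the refit, with `k = |S_D|`. -/
def refitDen₁ (T k : ℕ) (X lam b φ : ℝ) : ℝ :=
  φ ^ 2 - X * √T * (lam * k + b * φ * √T * √k)

/-- The denominator in the second lower bound on `A_K` for the refit; `R` is `R_ℳ`. -/
def refitDen₂ (T k : ℕ) (X φ R : ℝ) : ℝ := φ - 2 * R * X * √T * √k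

/-- The rate `R_ℳ'`. -/
def RM' (T k : ℕ) (lam pmin b φ A : ℝ) : ℝ :=
  (Ap pmin b / pmin) ^ (T + 1) * T * A * (lam * √k * φ⁻¹ / 2 + b * √T)

/-- The rate `R_ℳ''`, from `R = R_ℳ` and `R' = R_ℳ'`. -/
def RM'' (T : ℕ) (pmin b A R R' : ℝ) : ℝ :=
  max R (R' + √(R' * R + (Ap pmin b / pmin) ^ (T + 1) * T * A * R ^ 2))

/-- The conditions on the constants. Positivity says that the eigenvalue bounds, `A_p` and the
lower bounds on `A_K` are finite. -/
structure RateConditions (T s k : ℕ) (X lam pmin b κ φ A : ℝ) : Prop where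
  b_lt : b < pmin
  kappa_pos : 0 < κ
  phi_pos : 0 < φ
  lassoDen_pos : 0 < lassoDen T s X lam b κ
  refitDen₁_pos : 0 < refitDen₁ T k X lam b φ
  refitDen₂_pos : 0 < refitDen₂ T k X φ (RM T s lam pmin b κ A)
  lasso_lt : 2 * κ ^ 2 * (lassoDen T s X lam b κ)⁻¹ < A
  refit_lt : max (2 * (φ ^ 2 / refitDen₁ T k X lam b φ))
    (φ / refitDen₂ T k X φ (RM T s lam pmin b κ A)) < A

/-- `pr t` is a (measurable) version of the conditional probability `P[D = t | X = ·]`, where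
`(X, D)` has law `P`. -/
def IsPropensityScore {E : Type*} [MeasurableSpace E] {T : ℕ} (P : Measure (E × Fin (T + 1)))
    (pr : Fin (T + 1) → E → ℝ) : Prop :=
  ∀ t, Measurable (pr t) ∧
    P[Set.indicator {z : E × Fin (T + 1) | z.2 = t} (fun _ => (1 : ℝ)) |
      MeasurableSpace.comap Prod.fst inferInstance] =ᵐ[P] fun z => pr t z.1

/-- The conclusion for one realization of the sample: whenever the bias bound, the eigenvalue bound
and the conditions on the constants hold for it, every refit on a set `Ŝ` of at most `s` covariates
that contains those selected by the group lasso satisfies both error bounds. -/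
def RefitBounds {n p T : ℕ} (x : Fin n → Fin p → ℝ) (d : Fin n → Fin (T + 1))
    (pr : Fin n → Fin (T + 1) → ℝ) (γs : Coef T p) (X lam pmin b κ A : ℝ)
    (Shat : Finset (Fin p)) (γt γh : Coef T p) : Prop :=
  let Ss := groupSupport γs
  let s := Ss.card
  let SD := Shat ∪ Ss
  let φ := sparseEigMin (gram x) SD
  let R := RM T s lam pmin b κ A
  let R'' := RM'' T pmin b A R (RM' T SD.card lam pmin b φ A)
  (∀ t : Fin T, propError x pr γs t.succ ≤ b) →
  IsRestrictedEigBound T (gram x) Ss κ →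
  RateConditions T s SD.card X lam pmin b κ φ A →
  IsGroupLasso x d lam γt →
  groupSupport γt ⊆ Shat → Shat.card ≤ s →
  IsRefit x d Shat γh →
  (∀ t : Fin T, propError x pr γh t.succ ≤ R'' + b) ∧
  (∀ t : Fin T, ∑ j, |γh t j - γs t j| ≤ √SD.card / φ * R'')

end PostMLogit

end

/-!
The loss exceeds its linearization at `γ*` by the average Bregman divergence of the log-partition
function, which is the centered cumulant generating function, under the fitted probabilities, of the
change of the indices. As the fitted probabilities are bounded below up to the bias `b`, this
divergence is strongly convex in the prediction norm, with modulus of order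
`(p_min - b) ^ (T + 1)`, as long as the indices change little. Optimality of the group lasso and the
restricted eigenvalue bound give a linear bound on its divergence in terms of its prediction norm;
optimality of the refit compares its divergence with that of the lasso and gives a quadratic
inequality. Either inequality is convex, so it passes to the point of the segment to `γ*` at which
strong convexity starts to fail, and the conditions on `A_K` exclude that such a point exists.

Randomness enters only through the noise: in all directions involving at most `2s` covariates, the
score should be at most `¾ λ √s / 𝒳` times the prediction norm. Fix `2s` columns and condition on
the covariates. The treatments are then independent, so by Hoeffding's lemma the coordinates of
the noise along an orthonormal basis of the span of these columns are sub-Gaussian. Writing the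
exponential of a squared norm as a Gaussian average of exponentials of linear forms, the squared
norm has an exponential moment of at most `√2 ^ (2sT)`. Markov's inequality and a union bound over
the `p ^ (2s)` choices of columns conclude.
-/

noncomputable section

namespace PostMLogit

section Weights

variable {ι : Type*} [Fintype ι] {w w' : ι → ℝ}

/-- The variance `∑ i, w i * V i ^ 2 - (∑ i, w i * V i) ^ 2` of the random variable with values
`V i` taken with weights `w i`. The weights may add up to less than `1`; the missing mass then sits
at the value `0`. -/
def weightedVar (w V : ι → ℝ) : ℝ := ∑ i, w i * V i ^ 2 - (∑ i, w i * V i) ^ 2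

/-- The exponential tilting of the weights `w` in the direction `V`. -/
def tilt (w V : ι → ℝ) (i : ι) : ℝ := w i * Real.exp (V i) / ∑ j, w j * Real.exp (V j)

lemma weightedVar_eq_sum_sub_sq (hw : ∑ i, w i = 1) (V : ι → ℝ) :
    weightedVar w V = ∑ i, w i * (V i - ∑ j, w j * V j) ^ 2 := by
  set a := ∑ j, w j * V j with ha
  have hexpand : ∀ i, w i * (V i - a) ^ 2 = w i * V i ^ 2 - 2 * a * (w i * V i) + a ^ 2 * w i :=
    fun i => by ring
  simp_rw [hexpand, Finset.sum_add_distrib, Finset.sum_sub_distrib, ← Finset.mul_sum, hw,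
    weightedVar, ← ha]
  ring

lemma weightedVar_nonneg (hw : w ∈ stdSimplex ℝ ι) (V : ι → ℝ) : 0 ≤ weightedVar w V := by
  rw [weightedVar_eq_sum_sub_sq hw.2]
  exact Finset.sum_nonneg fun i _ => mul_nonneg (hw.1 i) (sq_nonneg _)

lemma weightedVar_le_sq (hw : w ∈ stdSimplex ℝ ι) {V : ι → ℝ} {r : ℝ} (hV : ∀ i, |V i| ≤ r) :
    weightedVar w V ≤ r ^ 2 := by
  have hsq : ∑ i, w i * V i ^ 2 ≤ ∑ i, w i * r ^ 2 := Finset.sum_le_sum fun i _ =>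
    mul_le_mul_of_nonneg_left (sq_le_sq.2 ((hV i).trans (le_abs_self r))) (hw.1 i)
  rw [← Finset.sum_mul, hw.2, one_mul] at hsq
  exact (sub_le_self _ (sq_nonneg _)).trans hsq

lemma abs_sum_mul_le (hw : ∀ i, 0 ≤ w i) (hw1 : ∑ i, w i ≤ 1) {V : ι → ℝ} {r : ℝ} (hr : 0 ≤ r)
    (hV : ∀ i, |V i| ≤ r) : |∑ i, w i * V i| ≤ r :=
  calc |∑ i, w i * V i| ≤ ∑ i, |w i * V i| := Finset.abs_sum_le_sum_abs _ _
    _ ≤ ∑ i, w i * r := Finset.sum_le_sum fun i _ => by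
        rw [abs_mul, abs_of_nonneg (hw i)]
        exact mul_le_mul_of_nonneg_left (hV i) (hw i)
    _ = (∑ i, w i) * r := (Finset.sum_mul ..).symm
    _ ≤ r := mul_le_of_le_one_left hr hw1

lemma sq_mul_le_weightedVar {c : ℝ} (hc : 0 ≤ c) (hw : ∀ i, c ≤ w i) (hw1 : c ≤ 1 - ∑ i, w i)
    (V : ι → ℝ) : c ^ 2 * ∑ i, V i ^ 2 ≤ weightedVar w V := by
  have hcs : (∑ i, w i * V i) ^ 2 ≤ (∑ i, w i) * ∑ i, w i * V i ^ 2 :=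
    Finset.sum_sq_le_sum_mul_sum_of_sq_le_mul _ (fun i _ => hc.trans (hw i))
      (fun i _ => mul_nonneg (hc.trans (hw i)) (sq_nonneg _)) fun i _ => le_of_eq (by ring)
  have hmoment : c * ∑ i, V i ^ 2 ≤ ∑ i, w i * V i ^ 2 := by
    rw [Finset.mul_sum]
    exact Finset.sum_le_sum fun i _ => mul_le_mul_of_nonneg_right (hw i) (sq_nonneg _)
  have hsq : 0 ≤ ∑ i, V i ^ 2 := Finset.sum_nonneg fun i _ => sq_nonneg _
  calc c ^ 2 * ∑ i, V i ^ 2 = c * (c * ∑ i, V i ^ 2) := by ring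
    _ ≤ (1 - ∑ i, w i) * ∑ i, w i * V i ^ 2 :=
        mul_le_mul hw1 hmoment (mul_nonneg hc hsq) (hc.trans hw1)
    _ ≤ weightedVar w V := by unfold weightedVar; linarith

lemma sum_abs_mul_abs_le_sqrt_mul_sqrt (u V : ι → ℝ) :
    ∑ i, |u i| * |V i| ≤ √(∑ i, u i ^ 2) * √(∑ i, V i ^ 2) := by
  simpa only [sq_abs] using
    Real.sum_mul_le_sqrt_mul_sqrt Finset.univ (fun i => |u i|) fun i => |V i|

lemma abs_weightedVar_sub_le (hw : ∀ i, 0 ≤ w i) (hw1 : ∑ i, w i ≤ 1) (hw' : ∀ i, 0 ≤ w' i)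
    (hw1' : ∑ i, w' i ≤ 1) (V : ι → ℝ) :
    |weightedVar w' V - weightedVar w V| ≤
      3 * √(∑ i, (w' i - w i) ^ 2) * ∑ i, V i ^ 2 := by
  set e := √(∑ i, (w' i - w i) ^ 2)
  set η := √(∑ i, V i ^ 2)
  have hη0 : 0 ≤ η := Real.sqrt_nonneg _
  have hη2 : η ^ 2 = ∑ i, V i ^ 2 := Real.sq_sqrt (Finset.sum_nonneg fun _ _ => sq_nonneg _)
  have hVη : ∀ i, |V i| ≤ η := fun i => Real.abs_le_sqrt
    (Finset.single_le_sum (f := fun i => V i ^ 2) (fun _ _ => sq_nonneg _) (Finset.mem_univ i))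
  have hcs : ∑ i, |w' i - w i| * |V i| ≤ e * η := sum_abs_mul_abs_le_sqrt_mul_sqrt _ V
  have hmoment : |∑ i, (w' i - w i) * V i ^ 2| ≤ e * η * η :=
    calc |∑ i, (w' i - w i) * V i ^ 2| ≤ ∑ i, |(w' i - w i) * V i ^ 2| :=
          Finset.abs_sum_le_sum_abs _ _
      _ ≤ ∑ i, |w' i - w i| * |V i| * η := Finset.sum_le_sum fun i _ => by
          rw [abs_mul, abs_pow, sq, ← mul_assoc]
          exact mul_le_mul_of_nonneg_left (hVη i) (by positivity)
      _ ≤ e * η * η := by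
          rw [← Finset.sum_mul]; exact mul_le_mul_of_nonneg_right hcs hη0
  have hmean : |∑ i, (w' i - w i) * V i| ≤ e * η := by
    refine (Finset.abs_sum_le_sum_abs _ _).trans (le_trans (le_of_eq ?_) hcs)
    exact Finset.sum_congr rfl fun i _ => abs_mul _ _
  have hmeans : |∑ i, w' i * V i + ∑ i, w i * V i| ≤ 2 * η :=
    (abs_add_le _ _).trans (by
      linarith [abs_sum_mul_le hw hw1 hη0 hVη, abs_sum_mul_le hw' hw1' hη0 hVη])
  have hdiff : weightedVar w' V - weightedVar w V = ∑ i, (w' i - w i) * V i ^ 2 -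
      (∑ i, (w' i - w i) * V i) * (∑ i, w' i * V i + ∑ i, w i * V i) := by
    simp_rw [weightedVar, sub_mul, Finset.sum_sub_distrib]
    ring
  calc |weightedVar w' V - weightedVar w V| ≤ |∑ i, (w' i - w i) * V i ^ 2| +
        |∑ i, (w' i - w i) * V i| * |∑ i, w' i * V i + ∑ i, w i * V i| := by
        rw [hdiff, ← abs_mul]; exact abs_sub _ _
    _ ≤ e * η * η + e * η * (2 * η) := by gcongr
    _ = 3 * e * ∑ i, V i ^ 2 := by rw [← hη2]; ring

lemma sum_mul_exp_pos (hw : w ∈ stdSimplex ℝ ι) (V : ι → ℝ) : 0 < ∑ i, w i * Real.exp (V i) := by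
  obtain ⟨i, -, hi⟩ : ∃ i ∈ Finset.univ, 0 < w i :=
    Finset.exists_lt_of_sum_lt (f := fun _ => (0 : ℝ)) (by simp [hw.2])
  exact Finset.sum_pos' (fun j _ => mul_nonneg (hw.1 j) (Real.exp_pos _).le)
    ⟨i, Finset.mem_univ i, mul_pos hi (Real.exp_pos _)⟩

lemma tilt_mem_stdSimplex (hw : w ∈ stdSimplex ℝ ι) (V : ι → ℝ) : tilt w V ∈ stdSimplex ℝ ι := by
  have hpos := sum_mul_exp_pos hw V
  refine ⟨fun i => div_nonneg (mul_nonneg (hw.1 i) (Real.exp_pos _).le) hpos.le, ?_⟩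
  simp_rw [tilt, ← Finset.sum_div]
  exact div_self hpos.ne'

lemma exp_ge_quadratic {u : ℝ} (h : |u| ≤ 1 / 2) : 1 + u + 3 / 8 * u ^ 2 ≤ Real.exp u := by
  have htaylor : |Real.exp u - (1 + u + u ^ 2 / 2)| ≤ |u| ^ 3 * (2 / 9) := by
    have := Real.exp_bound (x := u) (by linarith) (n := 3) (by norm_num)
    norm_num [Finset.sum_range_succ, Nat.factorial] at this ⊢
    exact this
  have hcube : |u| ^ 3 ≤ 1 / 2 * u ^ 2 := by
    rw [pow_succ', sq_abs]
    exact mul_le_mul_of_nonneg_right h (sq_nonneg _)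
  nlinarith [(abs_le.1 htaylor).1, sq_nonneg u]

lemma one_add_weightedVar_mul_exp_le (hw : w ∈ stdSimplex ℝ ι) {V : ι → ℝ}
    (hV : ∀ i, |V i| ≤ 1 / 4) :
    (1 + 3 / 8 * weightedVar w V) * Real.exp (∑ i, w i * V i) ≤ ∑ i, w i * Real.exp (V i) := by
  set a := ∑ i, w i * V i with ha
  have hVa : ∀ i, |V i - a| ≤ 1 / 2 := fun i => (abs_sub _ _).trans (by
    linarith [hV i, abs_sum_mul_le hw.1 hw.2.le (by norm_num) hV])
  have hsum : ∑ i, w i * (1 + (V i - a) + 3 / 8 * (V i - a) ^ 2) = 1 + 3 / 8 * weightedVar w V := by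
    simp_rw [mul_add, mul_sub, Finset.sum_add_distrib, Finset.sum_sub_distrib, ← Finset.sum_mul,
      mul_left_comm (w _), ← Finset.mul_sum, ← ha, hw.2, weightedVar_eq_sum_sub_sq hw.2, ← ha]
    ring
  rw [← hsum, Finset.sum_mul]
  refine Finset.sum_le_sum fun i _ => ?_
  rw [mul_assoc, ← sub_add_cancel (V i) a, Real.exp_add, add_sub_cancel_right]
  exact mul_le_mul_of_nonneg_left
    (mul_le_mul_of_nonneg_right (exp_ge_quadratic (hVa i)) (Real.exp_pos a).le) (hw.1 i)

lemma weightedVar_le_log_sum_mul_exp (hw : w ∈ stdSimplex ℝ ι) {V : ι → ℝ}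
    (hV : ∀ i, |V i| ≤ 1 / 4) :
    9 / 25 * weightedVar w V ≤ Real.log (∑ i, w i * Real.exp (V i)) - ∑ i, w i * V i := by
  set y := 3 / 8 * weightedVar w V with hy
  have hy0 : 0 ≤ y := mul_nonneg (by norm_num) (weightedVar_nonneg hw V)
  have hy1 : y ≤ 3 / 128 := by linarith [weightedVar_le_sq hw hV]
  have hlog : Real.log (1 + y) + ∑ i, w i * V i ≤ Real.log (∑ i, w i * Real.exp (V i)) := by
    rw [← Real.log_exp (∑ i, w i * V i),
      ← Real.log_mul (by positivity) (Real.exp_pos _).ne']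
    exact Real.log_le_log (by positivity) (one_add_weightedVar_mul_exp_le hw hV)
  have hinv : (1 + y)⁻¹ ≤ 1 - 24 / 25 * y := by
    rw [inv_le_iff_one_le_mul₀ (by positivity)]
    nlinarith
  linarith [Real.one_sub_inv_le_log_of_pos (x := 1 + y) (by positivity)]

lemma log_sum_mul_exp_smul_le (hw : w ∈ stdSimplex ℝ ι) (V : ι → ℝ) {τ : ℝ} (h0 : 0 ≤ τ)
    (h1 : τ ≤ 1) :
    Real.log (∑ i, w i * Real.exp (τ * V i)) ≤ τ * Real.log (∑ i, w i * Real.exp (V i)) := by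
  have hjensen := (Real.concaveOn_rpow h0 h1).le_map_sum (t := Finset.univ) (w := w)
    (p := fun i => Real.exp (V i)) (fun i _ => hw.1 i) hw.2 fun i _ => (Real.exp_pos _).le
  simp only [smul_eq_mul, ← Real.exp_mul, mul_comm (V _) τ] at hjensen
  rw [← Real.log_rpow (sum_mul_exp_pos hw V)]
  exact Real.log_le_log (sum_mul_exp_pos hw fun i => τ * V i) hjensen

lemma one_sub_mul_tilt_le (hw : w ∈ stdSimplex ℝ ι) {V : ι → ℝ} {ρ : ℝ}
    (hV : ∀ i j, V i - V j ≤ ρ) (i : ι) : (1 - ρ) * tilt w V i ≤ w i := by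
  have hZ : (1 - ρ) * Real.exp (V i) ≤ ∑ j, w j * Real.exp (V j) :=
    calc (1 - ρ) * Real.exp (V i) = ∑ j, w j * ((1 - ρ) * Real.exp (V i)) := by
          rw [← Finset.sum_mul, hw.2, one_mul]
      _ ≤ ∑ j, w j * Real.exp (V j) := Finset.sum_le_sum fun j _ => by
          refine mul_le_mul_of_nonneg_left ?_ (hw.1 j)
          rw [← le_div_iff₀ (Real.exp_pos _), ← Real.exp_sub]
          linarith [Real.add_one_le_exp (V j - V i), hV i j]
  rw [tilt, ← mul_div_assoc, div_le_iff₀ (sum_mul_exp_pos hw V), mul_left_comm]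
  exact mul_le_mul_of_nonneg_left hZ (hw.1 i)

lemma one_sub_mul_le_tilt (hw : w ∈ stdSimplex ℝ ι) {V : ι → ℝ} {ρ : ℝ}
    (hV : ∀ i j, V i - V j ≤ ρ) (i : ι) : (1 - ρ) * w i ≤ tilt w V i := by
  have hZ : (1 - ρ) * ∑ j, w j * Real.exp (V j) ≤ Real.exp (V i) :=
    calc (1 - ρ) * ∑ j, w j * Real.exp (V j) = ∑ j, w j * ((1 - ρ) * Real.exp (V j)) := by
          rw [Finset.mul_sum]; exact Finset.sum_congr rfl fun j _ => mul_left_comm _ _ _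
      _ ≤ ∑ j, w j * Real.exp (V i) := Finset.sum_le_sum fun j _ => by
          refine mul_le_mul_of_nonneg_left ?_ (hw.1 j)
          rw [← le_div_iff₀ (Real.exp_pos _), ← Real.exp_sub]
          linarith [Real.add_one_le_exp (V i - V j), hV j i]
      _ = Real.exp (V i) := by rw [← Finset.sum_mul, hw.2, one_mul]
  rw [tilt, le_div_iff₀ (sum_mul_exp_pos hw V), mul_right_comm, mul_comm]
  exact mul_le_mul_of_nonneg_left hZ (hw.1 i)

-- Bounding both the weight of `i` and that of its complement gains the factor `2 - ρ`.
lemma two_sub_mul_tilt_sub_le (hw : w ∈ stdSimplex ℝ ι) {V : ι → ℝ} {ρ : ℝ}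
    (hV : ∀ i j, V i - V j ≤ ρ) (i : ι) : (2 - ρ) * (tilt w V i - w i) ≤ ρ := by
  classical
  have hcompl : ∀ q ∈ stdSimplex ℝ ι, 1 - q i = ∑ j ∈ Finset.univ.erase i, q j := fun q hq => by
    rw [← hq.2, ← Finset.add_sum_erase _ _ (Finset.mem_univ i), add_sub_cancel_left]
  have hi : (1 - ρ) * tilt w V i ≤ w i := one_sub_mul_tilt_le hw hV i
  have hrest : (1 - ρ) * (1 - w i) ≤ 1 - tilt w V i := by
    rw [hcompl w hw, hcompl _ (tilt_mem_stdSimplex hw V), Finset.mul_sum]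
    exact Finset.sum_le_sum fun j _ => one_sub_mul_le_tilt hw hV j
  linarith

lemma sum_mul_exp_sub_mean_le (hw : w ∈ stdSimplex ℝ ι) {V : ι → ℝ} {B : ℝ}
    (hB : ∀ i j, (V i - V j) ^ 2 ≤ B) :
    ∑ i, w i * Real.exp (V i - ∑ j, w j * V j) ≤ Real.exp (B / 8) := by
  have : Nonempty ι := by
    by_contra h
    rw [not_nonempty_iff] at h
    simpa using hw.2
  let _ : MeasurableSpace ι := ⊤
  set ν : Measure ι := ∑ i, ENNReal.ofReal (w i) • Measure.dirac i with hν
  have hintegral : ∀ g : ι → ℝ, ∫ i, g i ∂ν = ∑ i, w i * g i := fun g => by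
    rw [hν, integral_finsetSum_measure fun i _ =>
      (integrable_dirac (by simp)).smul_measure ENNReal.ofReal_ne_top]
    refine Finset.sum_congr rfl fun i _ => ?_
    rw [integral_smul_measure, integral_dirac, ENNReal.toReal_ofReal (hw.1 i), smul_eq_mul]
  have : IsProbabilityMeasure ν := ⟨by
    rw [hν, Measure.coe_finsetSum, Finset.sum_apply]
    simp [← ENNReal.ofReal_sum_of_nonneg fun i _ => hw.1 i, hw.2]⟩
  obtain ⟨imax, hmax⟩ := Finite.exists_max V
  obtain ⟨imin, hmin⟩ := Finite.exists_min V
  have hmgf := (hasSubgaussianMGF_of_mem_Icc (μ := ν) (X := V) (measurable_of_finite V).aemeasurable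
    (Filter.Eventually.of_forall fun i => ⟨hmin i, hmax i⟩)).mgf_le 1
  simp only [mgf, hintegral, one_mul] at hmgf
  refine hmgf.trans (Real.exp_le_exp.2 ?_)
  push_cast
  rw [Real.norm_eq_abs, div_pow, sq_abs]
  linarith [hB imax imin]

end Weights

section Gaussian

lemma integral_exp_sq_gaussianReal :
    ∫ g, Real.exp (g ^ 2 / 4) ∂(gaussianReal 0 1) = √2 := by
  have hdensity : ∀ g : ℝ, gaussianPDFReal 0 1 g • Real.exp (g ^ 2 / 4) =
      (√(2 * Real.pi))⁻¹ * Real.exp (-(1 / 4) * g ^ 2) := fun g => by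
    rw [gaussianPDFReal, smul_eq_mul, mul_assoc, ← Real.exp_add]
    simp only [NNReal.coe_one, mul_one, sub_zero]
    congr 2; ring
  simp_rw [integral_gaussianReal_eq_integral_smul one_ne_zero, hdensity]
  rw [integral_const_mul, integral_gaussian, inv_mul_eq_div, ← Real.sqrt_div (by positivity)]
  congr 1
  field_simp
  norm_num

lemma integrable_exp_sq_gaussianReal :
    Integrable (fun g => Real.exp (g ^ 2 / 4)) (gaussianReal 0 1) :=
  Integrable.of_integral_ne_zero (integral_exp_sq_gaussianReal.trans_ne (by positivity))

lemma integral_exp_mul_gaussianReal (y : ℝ) :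
    ∫ g, Real.exp (y * g) ∂(gaussianReal 0 1) = Real.exp (y ^ 2 / 2) := by
  simpa [mgf] using mgf_gaussianReal (p := gaussianReal 0 1) (X := id) Measure.map_id y

variable {D ι : Type*} [Fintype D] [Fintype ι]

lemma integral_exp_sum_mul_pi_gaussianReal (y : ι → ℝ) :
    ∫ g : ι → ℝ, Real.exp (∑ l, g l * y l) ∂(Measure.pi fun _ => gaussianReal 0 1) =
      Real.exp ((∑ l, y l ^ 2) / 2) := by
  simp_rw [Real.exp_sum, integral_fintype_prod_eq_prod fun l g => Real.exp (g * y l),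
    mul_comm _ (y _), integral_exp_mul_gaussianReal, ← Real.exp_sum, Finset.sum_div]

-- Gaussian linearization: `exp (‖y‖² / 2)` is the average of `exp ⟪g, y⟫` over a standard Gaussian
-- `g`, so that the hypothesis on exponentials of linear forms applies for each fixed `g`.
lemma sum_mul_exp_sq_le {W : D → ℝ} {Y : D → ι → ℝ}
    (hY : ∀ h : ι → ℝ, ∑ d, W d * Real.exp (∑ l, h l * Y d l) ≤ Real.exp ((∑ l, h l ^ 2) / 4)) :
    ∑ d, W d * Real.exp ((∑ l, Y d l ^ 2) / 2) ≤ √2 ^ Fintype.card ι := by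
  have hint : ∀ d, Integrable (fun g : ι → ℝ => W d * Real.exp (∑ l, g l * Y d l))
      (Measure.pi fun _ => gaussianReal 0 1) := fun d => by
    simp_rw [Real.exp_sum, mul_comm _ (Y d _)]
    exact (Integrable.fintype_prod fun l => integrable_exp_mul_gaussianReal (Y d l)).const_mul _
  have hintSq : Integrable (fun g : ι → ℝ => Real.exp ((∑ l, g l ^ 2) / 4))
      (Measure.pi fun _ => gaussianReal 0 1) := by
    simp_rw [Finset.sum_div, Real.exp_sum]
    exact Integrable.fintype_prod fun _ => integrable_exp_sq_gaussianReal
  calc ∑ d, W d * Real.exp ((∑ l, Y d l ^ 2) / 2)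
      = ∫ g : ι → ℝ, ∑ d, W d * Real.exp (∑ l, g l * Y d l)
          ∂(Measure.pi fun _ => gaussianReal 0 1) := by
        simp_rw [integral_finsetSum _ fun d _ => hint d, integral_const_mul,
          integral_exp_sum_mul_pi_gaussianReal]
    _ ≤ ∫ g : ι → ℝ, Real.exp ((∑ l, g l ^ 2) / 4) ∂(Measure.pi fun _ => gaussianReal 0 1) :=
        integral_mono (integrable_finsetSum _ fun d _ => hint d) hintSq hY
    _ = √2 ^ Fintype.card ι := by
        simp_rw [Finset.sum_div, Real.exp_sum,
          integral_fintype_prod_eq_prod fun (_ : ι) g => Real.exp (g ^ 2 / 4),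
          integral_exp_sq_gaussianReal, Finset.prod_const, Finset.card_univ]

end Gaussian

section Logit

variable {T : ℕ}

/-- The indices of all treatments: those of the nonbaseline treatments, and `0` for the baseline. -/
def withBaseline (v : Fin T → ℝ) : Fin (T + 1) → ℝ := Fin.cons 0 v

/-- The log-partition function of the multinomial logit model. -/
def logPartition (m : Fin T → ℝ) : ℝ := Real.log (1 + ∑ s, Real.exp (m s))

/-- The Bregman divergence of the log-partition function between `m + v` and `m`, the gradient of
`logPartition` at `m` being `mlogit m`. -/
def bregman (m v : Fin T → ℝ) : ℝ :=
  logPartition (m + v) - logPartition m - ∑ t : Fin T, mlogit m t.succ * v t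

lemma withBaseline_add (v v' : Fin T → ℝ) :
    withBaseline (v + v') = withBaseline v + withBaseline v' := by
  ext t
  refine Fin.cases ?_ (fun s => ?_) t <;> simp [withBaseline]

lemma withBaseline_smul (τ : ℝ) (v : Fin T → ℝ) : withBaseline (τ • v) = τ • withBaseline v := by
  ext t
  refine Fin.cases ?_ (fun s => ?_) t <;> simp [withBaseline]

lemma withBaseline_apply (v : Fin T → ℝ) (r : Fin (T + 1)) :
    withBaseline v r = ∑ t : Fin T, (if r = t.succ then 1 else 0) * v t := by
  refine Fin.cases ?_ (fun s => ?_) r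
  · simp [withBaseline, (Fin.succ_ne_zero _).symm]
  · simp [withBaseline]

lemma sum_mul_withBaseline (q : Fin (T + 1) → ℝ) (v : Fin T → ℝ) :
    ∑ t, q t * withBaseline v t = ∑ t : Fin T, q t.succ * v t := by
  simp [Fin.sum_univ_succ, withBaseline]

lemma weightedVar_withBaseline (q : Fin (T + 1) → ℝ) (v : Fin T → ℝ) :
    weightedVar q (withBaseline v) = weightedVar (fun t => q t.succ) v := by
  simp [weightedVar, Fin.sum_univ_succ, withBaseline]

lemma sum_withBaseline_sq (v : Fin T → ℝ) : ∑ t, withBaseline v t ^ 2 = ∑ t, v t ^ 2 := by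
  simp [Fin.sum_univ_succ, withBaseline]

lemma abs_withBaseline_le (v : Fin T → ℝ) (t : Fin (T + 1)) :
    |withBaseline v t| ≤ √(∑ t, v t ^ 2) := by
  rw [← sum_withBaseline_sq]
  exact Real.abs_le_sqrt (Finset.single_le_sum (f := fun t => withBaseline v t ^ 2)
    (fun _ _ => sq_nonneg _) (Finset.mem_univ t))

lemma withBaseline_sub_sq_le (v : Fin T → ℝ) (s t : Fin (T + 1)) :
    (withBaseline v s - withBaseline v t) ^ 2 ≤ 2 * ∑ t, v t ^ 2 := by
  rw [← sum_withBaseline_sq]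
  rcases eq_or_ne s t with rfl | hst
  · rw [sub_self, zero_pow two_ne_zero]; positivity
  · have hpair : withBaseline v s ^ 2 + withBaseline v t ^ 2 ≤ ∑ t, withBaseline v t ^ 2 := by
      rw [← Finset.sum_pair hst (f := fun t => withBaseline v t ^ 2)]
      exact Finset.sum_le_sum_of_subset_of_nonneg (Finset.subset_univ _) fun _ _ _ => sq_nonneg _
    nlinarith [sq_nonneg (withBaseline v s + withBaseline v t)]

lemma sum_succ_eq_one_sub {q : Fin (T + 1) → ℝ} (hq : ∑ t, q t = 1) :
    ∑ t : Fin T, q t.succ = 1 - q 0 := by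
  rw [Fin.sum_univ_succ] at hq; linarith

lemma partition_pos (m : Fin T → ℝ) : 0 < 1 + ∑ s, Real.exp (m s) := by positivity

lemma mlogit_eq (m : Fin T → ℝ) (t : Fin (T + 1)) :
    mlogit m t = Real.exp (withBaseline m t) / (1 + ∑ s, Real.exp (m s)) := by
  refine Fin.cases ?_ (fun s => ?_) t <;> simp [mlogit, withBaseline]

lemma mlogit_pos (m : Fin T → ℝ) (t : Fin (T + 1)) : 0 < mlogit m t := by
  rw [mlogit_eq]; exact div_pos (Real.exp_pos _) (partition_pos m)

lemma mlogit_mem_stdSimplex (m : Fin T → ℝ) : mlogit m ∈ stdSimplex ℝ (Fin (T + 1)) := by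
  refine ⟨fun t => (mlogit_pos m t).le, ?_⟩
  simp_rw [mlogit_eq, ← Finset.sum_div]
  rw [Fin.sum_univ_succ, div_eq_one_iff_eq (partition_pos m).ne']
  simp [withBaseline]

lemma log_mlogit (m : Fin T → ℝ) (t : Fin (T + 1)) :
    Real.log (mlogit m t) = withBaseline m t - logPartition m := by
  rw [mlogit_eq, Real.log_div (Real.exp_pos _).ne' (partition_pos m).ne', Real.log_exp,
    logPartition]

lemma partition_add (m v : Fin T → ℝ) :
    1 + ∑ s, Real.exp ((m + v) s) =
      (1 + ∑ s, Real.exp (m s)) * ∑ t, mlogit m t * Real.exp (withBaseline v t) := by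
  simp_rw [mlogit_eq, div_mul_eq_mul_div, ← Finset.sum_div]
  rw [mul_div_cancel₀ _ (partition_pos m).ne', Fin.sum_univ_succ]
  simp [withBaseline, Real.exp_add]

lemma mlogit_add (m v : Fin T → ℝ) : mlogit (m + v) = tilt (mlogit m) (withBaseline v) := by
  ext t
  rw [tilt, mlogit_eq (m + v), partition_add, withBaseline_add, Pi.add_apply, Real.exp_add,
    mlogit_eq m t, div_mul_eq_mul_div, div_div]

lemma bregman_eq_log (m v : Fin T → ℝ) :
    bregman m v = Real.log (∑ t, mlogit m t * Real.exp (withBaseline v t)) -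
      ∑ t, mlogit m t * withBaseline v t := by
  rw [bregman, logPartition, partition_add, Real.log_mul (partition_pos m).ne'
    (sum_mul_exp_pos (mlogit_mem_stdSimplex m) _).ne', ← logPartition, sum_mul_withBaseline]
  ring

lemma bregman_smul_le (m v : Fin T → ℝ) {τ : ℝ} (h0 : 0 ≤ τ) (h1 : τ ≤ 1) :
    bregman m (τ • v) ≤ τ * bregman m v := by
  simp_rw [bregman_eq_log, withBaseline_smul, Pi.smul_apply, smul_eq_mul, mul_left_comm _ τ,
    ← Finset.mul_sum, mul_sub]
  exact sub_le_sub_right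
    (log_sum_mul_exp_smul_le (mlogit_mem_stdSimplex m) (withBaseline v) h0 h1) _

lemma weightedVar_le_bregman (m : Fin T → ℝ) {v : Fin T → ℝ} (hv : √(∑ t, v t ^ 2) ≤ 1 / 4) :
    9 / 25 * weightedVar (fun t => mlogit m t.succ) v ≤ bregman m v := by
  rw [bregman_eq_log, ← weightedVar_withBaseline]
  exact weightedVar_le_log_sum_mul_exp (mlogit_mem_stdSimplex m)
    fun t => (abs_withBaseline_le v t).trans hv

lemma mlogit_add_sub_le (m : Fin T → ℝ) {v : Fin T → ℝ} (hv : √(∑ t, v t ^ 2) ≤ 1 / 4)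
    (t : Fin (T + 1)) : mlogit (m + v) t - mlogit m t ≤ √(∑ t, v t ^ 2) := by
  set η := √(∑ t, v t ^ 2) with hη
  have hη0 : 0 ≤ η := Real.sqrt_nonneg _
  have hosc : ∀ r s, withBaseline v r - withBaseline v s ≤ 3 / 2 * η := fun r s => by
    have hsq := withBaseline_sub_sq_le v r s
    rw [← Real.sq_sqrt (by positivity : 0 ≤ ∑ t, v t ^ 2), ← hη] at hsq
    exact abs_le_of_sq_le_sq' (by nlinarith) (by positivity) |>.2
  have htilt := two_sub_mul_tilt_sub_le (mlogit_mem_stdSimplex m) hosc t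
  rw [← mlogit_add] at htilt
  nlinarith

lemma abs_mlogit_add_sub_le (m : Fin T → ℝ) {v : Fin T → ℝ} (hv : √(∑ t, v t ^ 2) ≤ 1 / 4)
    (t : Fin (T + 1)) : |mlogit (m + v) t - mlogit m t| ≤ √(∑ t, v t ^ 2) := by
  have hneg := mlogit_add_sub_le (m + v) (v := -v) (by simpa using hv) t
  simp only [add_neg_cancel_right, Pi.neg_apply, neg_sq] at hneg
  exact abs_sub_le_iff.2 ⟨mlogit_add_sub_le m hv t, hneg⟩

-- Under overlap the variance is at least `pmin² ‖v‖²` for the true probabilities `q`; passing to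
-- the fitted ones costs at most `3 ‖mlogit m - q‖ ‖v‖²`.
lemma le_bregman_of_overlap {q : Fin (T + 1) → ℝ} {pmin : ℝ} (hpmin : 0 ≤ pmin)
    (hq : ∀ t, pmin ≤ q t) (hq1 : ∑ t, q t = 1) (m : Fin T → ℝ) {v : Fin T → ℝ}
    (hv : √(∑ t, v t ^ 2) ≤ 1 / 4) :
    9 / 25 * (pmin ^ 2 * ∑ t, v t ^ 2 -
      3 * √(∑ t : Fin T, (mlogit m t.succ - q t.succ) ^ 2) * ∑ t, v t ^ 2) ≤ bregman m v := by
  have hm := mlogit_mem_stdSimplex m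
  have hq0 : ∑ t : Fin T, q t.succ = 1 - q 0 := sum_succ_eq_one_sub hq1
  have hvar : pmin ^ 2 * ∑ t, v t ^ 2 ≤ weightedVar (fun t : Fin T => q t.succ) v :=
    sq_mul_le_weightedVar hpmin (fun t => hq t.succ) (by linarith [hq 0]) v
  have hpert := abs_weightedVar_sub_le (w := fun t : Fin T => q t.succ)
    (w' := fun t => mlogit m t.succ) (fun t => hpmin.trans (hq t.succ)) (by linarith [hq 0])
    (fun t => hm.1 t.succ) (by linarith [hm.1 0, sum_succ_eq_one_sub hm.2]) v
  linarith [weightedVar_le_bregman m hv, (abs_le.1 hpert).1]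

end Logit

section EmpMean

variable {n : ℕ}

lemma empMean_add (f g : Fin n → ℝ) :
    empMean (fun i => f i + g i) = empMean f + empMean g := by
  simp [empMean, Finset.sum_add_distrib, add_div]

lemma empMean_sub (f g : Fin n → ℝ) :
    empMean (fun i => f i - g i) = empMean f - empMean g := by
  simp [empMean, Finset.sum_sub_distrib, sub_div]

lemma empMean_const_mul (a : ℝ) (f : Fin n → ℝ) :
    empMean (fun i => a * f i) = a * empMean f := by
  simp [empMean, ← Finset.mul_sum, mul_div_assoc]

lemma empMean_sum {ι : Type*} (s : Finset ι) (f : ι → Fin n → ℝ) :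
    empMean (fun i => ∑ t ∈ s, f t i) = ∑ t ∈ s, empMean (f t) := by
  simp only [empMean]
  rw [Finset.sum_comm, Finset.sum_div]

lemma empMean_mono {f g : Fin n → ℝ} (h : ∀ i, f i ≤ g i) : empMean f ≤ empMean g :=
  div_le_div_of_nonneg_right (Finset.sum_le_sum fun i _ => h i) (Nat.cast_nonneg n)

lemma empMean_nonneg {f : Fin n → ℝ} (h : ∀ i, 0 ≤ f i) : 0 ≤ empMean f :=
  div_nonneg (Finset.sum_nonneg fun i _ => h i) (Nat.cast_nonneg n)

lemma abs_empMean_le (f : Fin n → ℝ) : |empMean f| ≤ empMean fun i => |f i| := by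
  rw [empMean, abs_div, Nat.abs_cast]
  exact div_le_div_of_nonneg_right (Finset.abs_sum_le_sum_abs _ _) (Nat.cast_nonneg n)

-- Not an equality, since the empirical mean over an empty sample is `0`.
lemma empMean_const_le {a : ℝ} (ha : 0 ≤ a) : empMean (fun _ : Fin n => a) ≤ a := by
  simp only [empMean, Finset.sum_const, Finset.card_univ, Fintype.card_fin, nsmul_eq_mul]
  exact div_le_of_le_mul₀ (Nat.cast_nonneg n) ha (mul_comm _ _).le

lemma empMean_mul_le (f g : Fin n → ℝ) :
    empMean (fun i => f i * g i) ≤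
      √(empMean fun i => f i ^ 2) * √(empMean fun i => g i ^ 2) := by
  unfold empMean
  rw [Real.sqrt_div' _ (Nat.cast_nonneg n), Real.sqrt_div' _ (Nat.cast_nonneg n),
    div_mul_div_comm, Real.mul_self_sqrt (Nat.cast_nonneg n)]
  exact div_le_div_of_nonneg_right (Real.sum_mul_le_sqrt_mul_sqrt _ _ _) (Nat.cast_nonneg n)

lemma abs_empMean_sum_mul_le {ι : Type*} [Fintype ι] (f g : Fin n → ι → ℝ) :
    |empMean fun i => ∑ t, f i t * g i t| ≤
      √(empMean fun i => ∑ t, f i t ^ 2) * √(empMean fun i => ∑ t, g i t ^ 2) := by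
  have hsq : ∀ (h : Fin n → ι → ℝ) i, √(∑ t, h i t ^ 2) ^ 2 = ∑ t, h i t ^ 2 :=
    fun h i => Real.sq_sqrt (Finset.sum_nonneg fun _ _ => sq_nonneg _)
  calc |empMean fun i => ∑ t, f i t * g i t|
      ≤ empMean fun i => √(∑ t, f i t ^ 2) * √(∑ t, g i t ^ 2) :=
        (abs_empMean_le _).trans (empMean_mono fun i => by
          rw [← Real.sqrt_mul (Finset.sum_nonneg fun _ _ => sq_nonneg _)]
          exact Real.abs_le_sqrt (Finset.sum_mul_sq_le_sq_mul_sq _ _ _))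
    _ ≤ √(empMean fun i => ∑ t, f i t ^ 2) * √(empMean fun i => ∑ t, g i t ^ 2) := by
        have hcs := empMean_mul_le (fun i => √(∑ t, f i t ^ 2)) fun i => √(∑ t, g i t ^ 2)
        simp_rw [hsq f, hsq g] at hcs
        exact hcs

lemma sqrt_empMean_add_sq_le (f g : Fin n → ℝ) :
    √(empMean fun i => (f i + g i) ^ 2) ≤
      √(empMean fun i => f i ^ 2) + √(empMean fun i => g i ^ 2) := by
  refine Real.sqrt_le_iff.2 ⟨by positivity, ?_⟩
  have hf := Real.sq_sqrt (empMean_nonneg (f := fun i => f i ^ 2) fun i => sq_nonneg _)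
  have hg := Real.sq_sqrt (empMean_nonneg (f := fun i => g i ^ 2) fun i => sq_nonneg _)
  have hexpand : (fun i => (f i + g i) ^ 2) = fun i => f i ^ 2 + (2 * (f i * g i) + g i ^ 2) := by
    ext i; ring
  rw [hexpand, empMean_add, empMean_add, empMean_const_mul]
  nlinarith [empMean_mul_le f g]

end EmpMean

section Index

variable {n p T : ℕ} (x : Fin n → Fin p → ℝ)

/-- The squared prediction norm `𝔼ₙ[‖(xᵢ'δ_t)_t‖₂²]` of the coefficients `δ`. -/
def predSq (δ : Coef T p) : ℝ := empMean fun i => ∑ t, index x δ i t ^ 2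

lemma index_add (γ δ : Coef T p) (i : Fin n) :
    index x (γ + δ) i = index x γ i + index x δ i := by
  ext t; simp [index, mul_add, Finset.sum_add_distrib]

lemma index_smul (τ : ℝ) (δ : Coef T p) (i : Fin n) :
    index x (τ • δ) i = τ • index x δ i := by
  ext t; simp [index, Finset.mul_sum, mul_left_comm]

lemma predSq_nonneg (δ : Coef T p) : 0 ≤ predSq x δ :=
  empMean_nonneg fun _ => Finset.sum_nonneg fun _ _ => sq_nonneg _

lemma predSq_smul (τ : ℝ) (δ : Coef T p) : predSq x (τ • δ) = τ ^ 2 * predSq x δ := by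
  simp_rw [predSq, index_smul, Pi.smul_apply, smul_eq_mul, mul_pow, ← Finset.mul_sum,
    empMean_const_mul]

lemma quadForm_gram (v : Fin p → ℝ) :
    quadForm (gram x) v = empMean fun i => (∑ j, x i j * v j) ^ 2 := by
  have hexpand : ∀ i, (∑ j, x i j * v j) ^ 2 = ∑ j, ∑ k, v j * (v k * (x i j * x i k)) :=
    fun i => by
      rw [sq, Finset.sum_mul_sum]
      exact Finset.sum_congr rfl fun j _ => Finset.sum_congr rfl fun k _ => by ring
  simp only [quadForm, dotProduct, Matrix.mulVec, gram, Matrix.of_apply, hexpand, empMean_sum,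
    empMean_const_mul, Finset.mul_sum]
  exact Finset.sum_congr rfl fun j _ => Finset.sum_congr rfl fun k _ => by ring

lemma quadForm_gram_nonneg (v : Fin p → ℝ) : 0 ≤ quadForm (gram x) v := by
  rw [quadForm_gram]; exact empMean_nonneg fun _ => sq_nonneg _

lemma sum_quadForm_gram (δ : Coef T p) : ∑ t, quadForm (gram x) (δ t) = predSq x δ := by
  simp_rw [quadForm_gram, predSq, empMean_sum, index]

lemma quadForm_gram_le_predSq (δ : Coef T p) (t : Fin T) :
    quadForm (gram x) (δ t) ≤ predSq x δ := by
  rw [← sum_quadForm_gram]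
  exact Finset.single_le_sum (f := fun t => quadForm (gram x) (δ t))
    (fun t _ => quadForm_gram_nonneg x (δ t)) (Finset.mem_univ t)

lemma mem_groupSupport {γ : Coef T p} {j : Fin p} : j ∈ groupSupport γ ↔ ∃ t, γ t j ≠ 0 := by
  simp [groupSupport]

lemma eq_zero_of_notMem_groupSupport {γ : Coef T p} {j : Fin p} (hj : j ∉ groupSupport γ)
    (t : Fin T) : γ t j = 0 := by
  simpa using fun h => hj (mem_groupSupport.2 ⟨t, h⟩)

lemma groupSupport_add_subset (γ γ' : Coef T p) :
    groupSupport (γ + γ') ⊆ groupSupport γ ∪ groupSupport γ' := fun j hj => by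
  contrapose! hj
  rw [Finset.mem_union, not_or] at hj
  simp [mem_groupSupport, eq_zero_of_notMem_groupSupport hj.1,
    eq_zero_of_notMem_groupSupport hj.2]

lemma groupSupport_neg (γ : Coef T p) : groupSupport (-γ) = groupSupport γ := by
  ext j; simp [mem_groupSupport]

lemma groupSupport_sub_subset (γ γ' : Coef T p) :
    groupSupport (γ - γ') ⊆ groupSupport γ ∪ groupSupport γ' := by
  simpa only [sub_eq_add_neg, groupSupport_neg] using groupSupport_add_subset γ (-γ')

lemma groupSupport_smul_subset (τ : ℝ) (γ : Coef T p) :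
    groupSupport (τ • γ) ⊆ groupSupport γ := fun j hj => by
  contrapose! hj
  simp [mem_groupSupport, eq_zero_of_notMem_groupSupport hj]

lemma sum_eq_sum_of_groupSupport_subset {S : Finset (Fin p)} {δ : Coef T p}
    (hδ : groupSupport δ ⊆ S) (t : Fin T) {f : Fin p → ℝ → ℝ} (hf : ∀ j, f j 0 = 0) :
    ∑ j, f j (δ t j) = ∑ j ∈ S, f j (δ t j) :=
  (Finset.sum_subset (Finset.subset_univ S) fun j _ hj => by
    rw [eq_zero_of_notMem_groupSupport (fun h => hj (hδ h)), hf]).symm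

variable {x}

lemma sparseEigMin_sq_mul_le {S : Finset (Fin p)} (hφ : 0 < sparseEigMin (gram x) S)
    {v : Fin p → ℝ} (hv : ∀ j, j ∉ S → v j = 0) :
    sparseEigMin (gram x) S ^ 2 * ∑ j, v j ^ 2 ≤ quadForm (gram x) v := by
  rcases eq_or_ne v 0 with rfl | hv0
  · simp [quadForm]
  have hpos : 0 < ∑ j, v j ^ 2 := by
    obtain ⟨j, hj⟩ := Function.ne_iff.1 hv0
    exact Finset.sum_pos' (fun _ _ => sq_nonneg _) ⟨j, Finset.mem_univ j, sq_pos_iff.2 hj⟩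
  unfold sparseEigMin at hφ ⊢
  rw [Real.sq_sqrt (Real.sqrt_pos.1 hφ).le, ← le_div_iff₀ hpos]
  refine csInf_le ⟨0, ?_⟩ ⟨v, hv0, hv, rfl⟩
  rintro r ⟨δ, -, -, rfl⟩
  exact div_nonneg (quadForm_gram_nonneg x δ) (Finset.sum_nonneg fun j _ => sq_nonneg _)

lemma nonempty_of_sparseEigMin_pos {Q : Matrix (Fin p) (Fin p) ℝ} {S : Finset (Fin p)}
    (hφ : 0 < sparseEigMin Q S) : S.Nonempty := by
  contrapose! hφ
  have hempty : {r : ℝ | ∃ δ : Fin p → ℝ, δ ≠ 0 ∧ (∀ j, j ∉ S → δ j = 0) ∧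
      r = quadForm Q δ / ∑ j, δ j ^ 2} = ∅ :=
    Set.eq_empty_of_forall_notMem fun r ⟨δ, hδ, hsupp, _⟩ =>
      hδ (funext fun j => hsupp j (by simp [hφ]))
  rw [sparseEigMin, hempty, Real.sInf_empty, Real.sqrt_zero]

lemma sqrt_sum_sq_index_le {X : ℝ} (hX0 : 0 ≤ X) (hX : ∀ i j, |x i j| ≤ X) {S : Finset (Fin p)}
    (hφ : 0 < sparseEigMin (gram x) S) {δ : Coef T p} (hδ : groupSupport δ ⊆ S) (i : Fin n) :
    √(∑ t, index x δ i t ^ 2) ≤ X * √S.card / sparseEigMin (gram x) S * √(predSq x δ) := by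
  set φ := sparseEigMin (gram x) S with hφd
  refine Real.sqrt_le_iff.2 ⟨by positivity, ?_⟩
  rw [mul_pow, div_pow, mul_pow, Real.sq_sqrt (Nat.cast_nonneg _),
    Real.sq_sqrt (predSq_nonneg x δ), div_mul_eq_mul_div, le_div_iff₀ (by positivity),
    ← sum_quadForm_gram, Finset.mul_sum, Finset.sum_mul]
  refine Finset.sum_le_sum fun t _ => ?_
  have hcs : index x δ i t ^ 2 ≤ (X ^ 2 * S.card) * ∑ j, δ t j ^ 2 := by
    rw [index, sum_eq_sum_of_groupSupport_subset hδ t (f := fun j u => x i j * u) (by simp)]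
    calc (∑ j ∈ S, x i j * δ t j) ^ 2 ≤ (∑ j ∈ S, x i j ^ 2) * ∑ j ∈ S, δ t j ^ 2 :=
          Finset.sum_mul_sq_le_sq_mul_sq _ _ _
      _ ≤ (∑ _ ∈ S, X ^ 2) * ∑ j, δ t j ^ 2 :=
          mul_le_mul (Finset.sum_le_sum fun _ _ => sq_le_sq' (abs_le.1 (hX i _)).1
              (abs_le.1 (hX i _)).2)
            (Finset.sum_le_univ_sum_of_nonneg fun _ => sq_nonneg _) (by positivity)
            (by positivity)
      _ = (X ^ 2 * S.card) * ∑ j, δ t j ^ 2 := by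
          rw [Finset.sum_const, nsmul_eq_mul, mul_comm (X ^ 2)]
  calc index x δ i t ^ 2 * φ ^ 2 ≤ (X ^ 2 * S.card) * (∑ j, δ t j ^ 2) * φ ^ 2 :=
        mul_le_mul_of_nonneg_right hcs (sq_nonneg _)
    _ = (X ^ 2 * S.card) * (φ ^ 2 * ∑ j, δ t j ^ 2) := by ring
    _ ≤ X ^ 2 * S.card * quadForm (gram x) (δ t) :=
        mul_le_mul_of_nonneg_left (sparseEigMin_sq_mul_le hφ fun j hj =>
          eq_zero_of_notMem_groupSupport (fun h => hj (hδ h)) t) (by positivity)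

lemma sum_abs_le_sqrt_predSq {S : Finset (Fin p)} (hφ : 0 < sparseEigMin (gram x) S)
    {δ : Coef T p} (hδ : groupSupport δ ⊆ S) (t : Fin T) :
    ∑ j, |δ t j| ≤ √S.card / sparseEigMin (gram x) S * √(predSq x δ) := by
  set φ := sparseEigMin (gram x) S with hφd
  have hl2 : √(∑ j ∈ S, |δ t j| ^ 2) ≤ √(predSq x δ) / φ := by
    rw [le_div_iff₀ hφ]
    refine Real.le_sqrt_of_sq_le ?_
    simp_rw [mul_pow, sq_abs, Real.sq_sqrt (Finset.sum_nonneg fun _ _ => sq_nonneg (δ t _)),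
      ← sum_eq_sum_of_groupSupport_subset hδ t (f := fun _ u => u ^ 2) (by simp),
      mul_comm _ (φ ^ 2)]
    exact (sparseEigMin_sq_mul_le hφ fun j hj =>
      eq_zero_of_notMem_groupSupport (fun h => hj (hδ h)) t).trans (quadForm_gram_le_predSq x δ t)
  calc ∑ j, |δ t j| = ∑ j ∈ S, 1 * |δ t j| := by
        simp_rw [one_mul]
        exact sum_eq_sum_of_groupSupport_subset hδ t (f := fun _ u => |u|) (by simp)
    _ ≤ √(∑ j ∈ S, 1 ^ 2) * √(∑ j ∈ S, |δ t j| ^ 2) := Real.sum_mul_le_sqrt_mul_sqrt S _ _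
    _ ≤ √S.card * (√(predSq x δ) / φ) := mul_le_mul (by simp) hl2 (by positivity) (by positivity)
    _ = √S.card / φ * √(predSq x δ) := by ring

end Index

section Loss

variable {n p T : ℕ} (x : Fin n → Fin p → ℝ) (d : Fin n → Fin (T + 1))
  (pr : Fin n → Fin (T + 1) → ℝ)

/-- The Bregman divergence of the loss between `γ + δ` and `γ`. It does not involve the observed
treatments, which enter the loss linearly. -/
def lossBregman (γ δ : Coef T p) : ℝ := empMean fun i => bregman (index x γ i) (index x δ i)

/-- The derivative of the loss at `γ` in the direction `δ`. -/
def lossDeriv (γ δ : Coef T p) : ℝ :=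
  empMean fun i => ∑ t : Fin T,
    (mlogit (index x γ i) t.succ - if d i = t.succ then 1 else 0) * index x δ i t

/-- The part of minus the derivative of the loss in the direction `δ` that is due to the noise
`𝟙{dᵢ = t} - p_t(xᵢ)`. -/
def noise (δ : Coef T p) : ℝ :=
  empMean fun i => ∑ t : Fin T, ((if d i = t.succ then 1 else 0) - pr i t.succ) * index x δ i t

/-- The `ℓ₂` norm over the nonbaseline treatments of the prediction errors `propError`. -/
def totalError (γ : Coef T p) : ℝ :=
  √(empMean fun i => ∑ t : Fin T, (mlogit (index x γ i) t.succ - pr i t.succ) ^ 2)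

/-- The noise, relative to the prediction norm, is at most `ν` in all directions that use at most
`k` covariates. -/
def NoiseBound (k : ℕ) (ν : ℝ) : Prop :=
  ∀ δ : Coef T p, (groupSupport δ).card ≤ k → |noise x d pr δ| ≤ ν * √(predSq x δ)

lemma loss_eq (γ : Coef T p) :
    loss x d γ =
      empMean fun i => logPartition (index x γ i) - withBaseline (index x γ i) (d i) := by
  rw [loss, ← empMean_sum]
  congr 1; ext i
  rw [Finset.sum_eq_single (d i) (fun t _ ht => by simp [ht.symm]) (by simp), log_mlogit]
  simp

lemma loss_add (γ δ : Coef T p) :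
    loss x d (γ + δ) = loss x d γ + lossBregman x γ δ + lossDeriv x d γ δ := by
  rw [loss_eq, loss_eq, lossBregman, lossDeriv, ← empMean_add, ← empMean_add]
  congr 1; ext i
  rw [index_add, withBaseline_add, Pi.add_apply, withBaseline_apply (index x δ i), bregman]
  simp_rw [sub_mul, Finset.sum_sub_distrib]
  ring

lemma lossBregman_smul_le (γ δ : Coef T p) {τ : ℝ} (h0 : 0 ≤ τ) (h1 : τ ≤ 1) :
    lossBregman x γ (τ • δ) ≤ τ * lossBregman x γ δ := by
  rw [lossBregman, lossBregman, ← empMean_const_mul]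
  exact empMean_mono fun i => by rw [index_smul]; exact bregman_smul_le _ _ h0 h1

lemma lossDeriv_eq_sub_noise (γ δ : Coef T p) :
    lossDeriv x d γ δ = (empMean fun i => ∑ t : Fin T,
      (mlogit (index x γ i) t.succ - pr i t.succ) * index x δ i t) - noise x d pr δ := by
  rw [lossDeriv, noise, ← empMean_sub]
  congr 1; ext i
  rw [← Finset.sum_sub_distrib]
  exact Finset.sum_congr rfl fun t _ => by ring

variable {x d pr}

lemma abs_lossDeriv_le {k : ℕ} {ν : ℝ} (hν : NoiseBound x d pr k ν) (γ : Coef T p) {δ : Coef T p}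
    (hδ : (groupSupport δ).card ≤ k) :
    |lossDeriv x d γ δ| ≤ (totalError x pr γ + ν) * √(predSq x δ) := by
  rw [lossDeriv_eq_sub_noise x d pr, add_mul]
  exact (abs_sub _ _).trans (add_le_add (abs_empMean_sum_mul_le
    (fun i (t : Fin T) => mlogit (index x γ i) t.succ - pr i t.succ) (index x δ)) (hν δ hδ))

lemma totalError_le {γ : Coef T p} {b : ℝ} (hb0 : 0 ≤ b)
    (hb : ∀ t : Fin T, propError x pr γ t.succ ≤ b) : totalError x pr γ ≤ b * √T := by
  refine Real.sqrt_le_iff.2 ⟨by positivity, ?_⟩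
  rw [mul_pow, Real.sq_sqrt (Nat.cast_nonneg _), empMean_sum]
  calc _ ≤ ∑ _t : Fin T, b ^ 2 := Finset.sum_le_sum fun t _ => (Real.sqrt_le_left hb0).1 (hb t)
    _ = b ^ 2 * T := by simp [mul_comm]

lemma le_lossBregman {pmin : ℝ} (hpmin : 0 ≤ pmin) (hpr : ∀ i t, pmin ≤ pr i t)
    (hpr1 : ∀ i, ∑ t, pr i t = 1) (γ : Coef T p) {δ : Coef T p} {L : ℝ}
    (hL : ∀ i, √(∑ t, index x δ i t ^ 2) ≤ L * √(predSq x δ))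
    (hL1 : L * √(predSq x δ) ≤ 1 / 4) :
    9 / 25 * (pmin ^ 2 - 3 * L * totalError x pr γ) * predSq x δ ≤ lossBregman x γ δ := by
  rcases isEmpty_or_nonempty (Fin n) with _ | ⟨⟨i₀⟩⟩
  · simp [predSq, lossBregman, empMean]
  set e : Fin n → ℝ := fun i => √(∑ t : Fin T, (mlogit (index x γ i) t.succ - pr i t.succ) ^ 2)
  set w : Fin n → ℝ := fun i => √(∑ t, index x δ i t ^ 2)
  set M := L * √(predSq x δ)
  have hM0 : 0 ≤ M := (Real.sqrt_nonneg _).trans (hL i₀)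
  have hw : ∀ i, w i ^ 2 = ∑ t, index x δ i t ^ 2 :=
    fun i => Real.sq_sqrt (Finset.sum_nonneg fun _ _ => sq_nonneg _)
  have he : ∀ i, e i ^ 2 = ∑ t : Fin T, (mlogit (index x γ i) t.succ - pr i t.succ) ^ 2 :=
    fun i => Real.sq_sqrt (Finset.sum_nonneg fun _ _ => sq_nonneg _)
  have hpoint : ∀ i, 9 / 25 * (pmin ^ 2 * w i ^ 2 - 3 * M * (e i * w i)) ≤
      bregman (index x γ i) (index x δ i) := fun i => by
    have hi := le_bregman_of_overlap hpmin (hpr i) (hpr1 i) (index x γ i) ((hL i).trans hL1)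
    rw [← hw] at hi
    have hew : 0 ≤ e i * w i := mul_nonneg (Real.sqrt_nonneg _) (Real.sqrt_nonneg _)
    nlinarith [mul_le_mul_of_nonneg_left (hL i) hew]
  have hmean := empMean_mono hpoint
  have hcs : (empMean fun i => e i * w i) ≤ totalError x pr γ * √(predSq x δ) := by
    have h := empMean_mul_le e w
    simp_rw [he, hw] at h
    exact h
  simp_rw [empMean_const_mul, empMean_sub, empMean_const_mul, hw] at hmean
  refine le_trans ?_ hmean
  rw [← predSq]
  calc 9 / 25 * (pmin ^ 2 - 3 * L * totalError x pr γ) * predSq x δ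
      = 9 / 25 * (pmin ^ 2 * predSq x δ - 3 * M * (totalError x pr γ * √(predSq x δ))) := by
        have hsq := Real.mul_self_sqrt (predSq_nonneg x δ)
        linear_combination (27 / 25 * L * totalError x pr γ) * hsq
    _ ≤ _ := by gcongr

lemma propError_add_le {γ δ : Coef T p} (hv : ∀ i, √(∑ t, index x δ i t ^ 2) ≤ 1 / 4)
    (t : Fin (T + 1)) : propError x pr (γ + δ) t ≤ √(predSq x δ) + propError x pr γ t := by
  have htri := sqrt_empMean_add_sq_le
    (fun i => mlogit (index x (γ + δ) i) t - mlogit (index x γ i) t)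
    (fun i => mlogit (index x γ i) t - pr i t)
  simp only [sub_add_sub_cancel] at htri
  refine htri.trans (add_le_add (Real.sqrt_le_sqrt (empMean_mono fun i => ?_)) le_rfl)
  rw [← Real.sqrt_le_sqrt_iff (Finset.sum_nonneg fun _ _ => sq_nonneg _), Real.sqrt_sq_eq_abs,
    index_add]
  exact abs_mlogit_add_sub_le (index x γ i) (hv i) t

end Loss

section Rates

variable {T s k : ℕ} {X lam pmin b κ φ A : ℝ}

lemma Ap_div (hpmin : 0 < pmin) (hb : b < pmin) : Ap pmin b / pmin = (pmin - b)⁻¹ := by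
  rw [Ap, max_eq_right (sub_pos.2 hb).le, div_right_comm, div_self hpmin.ne', one_div]

lemma RM_eq_mul (T s : ℕ) (lam pmin b κ A : ℝ) :
    RM T s lam pmin b κ A = A / 2 * RM T s lam pmin b κ 2 := by
  simp only [RM]; ring

lemma RM_two_eq (hpmin : 0 < pmin) (hb : b < pmin) :
    (pmin - b) ^ (T + 1) * RM T s lam pmin b κ 2 =
      T * (12 * (lam * √s / κ) + 16 * (b * √T)) := by
  have hc : (pmin - b) ^ (T + 1) ≠ 0 := (pow_pos (sub_pos.2 hb) _).ne'
  rw [RM, Ap_div hpmin hb, inv_pow]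
  field_simp
  ring

lemma le_mul_RM_two (hT : 0 < T) (hpmin : 0 < pmin) (hb0 : 0 ≤ b) (hb : b < pmin)
    (hlam : 0 ≤ lam) (hκ : 0 ≤ κ) :
    12 * (lam * √s / κ) + 16 * (b * √T) ≤ (pmin - b) ^ (T + 1) * RM T s lam pmin b κ 2 := by
  rw [RM_two_eq hpmin hb]
  exact le_mul_of_one_le_left (by positivity) (by exact_mod_cast hT)

lemma RM_two_nonneg (hpmin : 0 < pmin) (hb0 : 0 ≤ b) (hb : b < pmin) (hlam : 0 ≤ lam)
    (hκ : 0 ≤ κ) : 0 ≤ RM T s lam pmin b κ 2 := by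
  have hc : 0 < (pmin - b) ^ (T + 1) := pow_pos (sub_pos.2 hb) _
  refine nonneg_of_mul_nonneg_right ?_ hc
  rw [RM_two_eq hpmin hb]
  positivity

lemma RateConditions.two_lt (h : RateConditions T s k X lam pmin b κ φ A) (hX : 0 ≤ X)
    (hlam : 0 ≤ lam) (hb : 0 ≤ b) : 2 < A := by
  have hκ := h.kappa_pos
  have hden : lassoDen T s X lam b κ ≤ κ ^ 2 := sub_le_self _ (by positivity)
  refine lt_of_le_of_lt ?_ h.lasso_lt
  rw [← div_eq_mul_inv, le_div_iff₀ h.lassoDen_pos]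
  linarith

-- The second lower bound on `A` reads `A² y √T < (A - 1) φ`, where `y = X √k R` and `R` is the left
-- factor below, and `A - 1 ≤ A² / 4`.
lemma RateConditions.RM_two_mul_le (h : RateConditions T s k X lam pmin b κ φ A) (hT : 0 < T)
    (hX : 0 ≤ X) (hlam : 0 ≤ lam) (hb : 0 ≤ b) :
    X * √k / φ * RM T s lam pmin b κ 2 ≤ 1 / 4 := by
  have hκ := h.kappa_pos
  have hφ := h.phi_pos
  have hA := h.two_lt hX hlam hb
  have hR := RM_two_nonneg (T := T) (s := s) (hb.trans_lt h.b_lt) hb h.b_lt hlam hκ.le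
  have hrefit := (le_max_right _ _).trans_lt h.refit_lt
  rw [div_lt_iff₀ h.refitDen₂_pos, refitDen₂, RM_eq_mul] at hrefit
  set R := RM T s lam pmin b κ 2
  set y := X * √k * R with hy
  have hy0 : 0 ≤ y := by positivity
  have hyT : y ≤ y * √T :=
    le_mul_of_one_le_right hy0 (Real.one_le_sqrt.2 (by exact_mod_cast hT))
  have hAy : A ^ 2 * y ≤ A ^ 2 * (φ / 4) :=
    calc A ^ 2 * y ≤ A ^ 2 * (y * √T) := by gcongr
      _ ≤ (A - 1) * φ := by rw [hy]; linarith
      _ ≤ A ^ 2 * (φ / 4) := by nlinarith [mul_nonneg (sq_nonneg (A - 2)) hφ.le]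
  rw [div_mul_eq_mul_div, div_le_iff₀ hφ]
  linarith [le_of_mul_le_mul_left hAy (by positivity)]

end Rates

section BasicInequalities

variable {n p T : ℕ} {x : Fin n → Fin p → ℝ}

lemma groupNormOn_nonneg (S : Finset (Fin p)) (δ : Coef T p) : 0 ≤ groupNormOn S δ :=
  Finset.sum_nonneg fun _ _ => Real.sqrt_nonneg _

lemma groupNormOn_eq_zero {S : Finset (Fin p)} {δ : Coef T p} (h : ∀ j ∈ S, ∀ t, δ t j = 0) :
    groupNormOn S δ = 0 :=
  Finset.sum_eq_zero fun j hj => by simp [h j hj]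

lemma groupNormOn_add_compl (S : Finset (Fin p)) (δ : Coef T p) :
    groupNormOn S δ + groupNormOn Sᶜ δ = groupNorm δ :=
  Finset.sum_add_sum_compl S _

lemma groupNormOn_sub_le (S : Finset (Fin p)) (γ δ : Coef T p) :
    groupNormOn S (γ - δ) ≤ groupNormOn S γ + groupNormOn S δ := by
  have hnorm : ∀ v : Fin T → ℝ, √(∑ t, v t ^ 2) = ‖WithLp.toLp 2 v‖ := fun v => by
    simp [EuclideanSpace.norm_eq]
  simp_rw [groupNormOn, ← Finset.sum_add_distrib, hnorm]
  exact Finset.sum_le_sum fun j _ =>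
    norm_sub_le (WithLp.toLp 2 fun t => γ t j) (WithLp.toLp 2 fun t => δ t j)

lemma groupNorm_sub_groupNorm_le (γ γ' : Coef T p) :
    groupNorm γ - groupNorm γ' ≤ groupNormOn (groupSupport γ) (γ' - γ) -
      groupNormOn (groupSupport γ)ᶜ (γ' - γ) := by
  set S := groupSupport γ
  have hzero : ∀ j ∈ Sᶜ, ∀ t, γ t j = 0 := fun j hj =>
    eq_zero_of_notMem_groupSupport (Finset.mem_compl.1 hj)
  have hcompl : groupNormOn Sᶜ (γ' - γ) = groupNormOn Sᶜ γ' :=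
    Finset.sum_congr rfl fun j hj => by simp [hzero j hj]
  have htri := groupNormOn_sub_le S γ' (γ' - γ)
  rw [sub_sub_cancel] at htri
  rw [← groupNormOn_add_compl S γ, ← groupNormOn_add_compl S γ', groupNormOn_eq_zero hzero, hcompl]
  linarith

lemma groupNormOn_le_sqrt_card_mul (S : Finset (Fin p)) (δ : Coef T p) :
    groupNormOn S δ ≤ √S.card * √(∑ t, ∑ j ∈ S, δ t j ^ 2) := by
  have hcs := Real.sum_mul_le_sqrt_mul_sqrt S (fun _ => 1) fun j => √(∑ t, δ t j ^ 2)
  have hsq : ∀ j, √(∑ t, δ t j ^ 2) ^ 2 = ∑ t, δ t j ^ 2 :=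
    fun j => Real.sq_sqrt (Finset.sum_nonneg fun _ _ => sq_nonneg _)
  simp_rw [hsq] at hcs
  rw [Finset.sum_comm] at hcs
  simpa [groupNormOn] using hcs

lemma IsRestrictedEigBound.groupNormOn_le {S : Finset (Fin p)} {κ : ℝ} (hκ : 0 < κ)
    (h : IsRestrictedEigBound T (gram x) S κ) {δ : Coef T p}
    (hcone : groupNormOn Sᶜ δ ≤ 4 * groupNormOn S δ) :
    groupNormOn S δ ≤ √S.card / κ * √(predSq x δ) := by
  rcases eq_or_ne δ 0 with rfl | hδ
  · rw [groupNormOn_eq_zero (by simp)]; positivity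
  have heig := h δ hδ hcone
  rw [sum_quadForm_gram] at heig
  have hpos : 0 < ∑ t, ∑ j ∈ S, δ t j ^ 2 := by
    by_contra! hle
    linarith [div_nonpos_of_nonneg_of_nonpos (predSq_nonneg x δ) hle, pow_pos hκ 2]
  rw [le_div_iff₀ hpos] at heig
  calc groupNormOn S δ ≤ √S.card * √(∑ t, ∑ j ∈ S, δ t j ^ 2) := groupNormOn_le_sqrt_card_mul S δ
    _ ≤ √S.card * (√(predSq x δ) / κ) := by
        refine mul_le_mul_of_nonneg_left ((le_div_iff₀' hκ).2 (Real.le_sqrt_of_sq_le ?_))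
          (Real.sqrt_nonneg _)
        rwa [mul_pow, Real.sq_sqrt hpos.le]
    _ = √S.card / κ * √(predSq x δ) := by ring

lemma IsRestrictedEigBound.le_of_abs_le {S : Finset (Fin p)} {κ X : ℝ}
    (h : IsRestrictedEigBound T (gram x) S κ) (hT : 0 < T) (hS : S.Nonempty) (hX0 : 0 ≤ X)
    (hX : ∀ i j, |x i j| ≤ X) : κ ≤ X := by
  obtain ⟨j₀, hj₀⟩ := hS
  have hTpos : (0 : ℝ) < T := by exact_mod_cast hT
  set δ : Coef T p := fun _ => Pi.single j₀ 1 with hδ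
  have hne : δ ≠ 0 := fun h0 => by simpa [hδ] using congrFun (congrFun h0 ⟨0, hT⟩) j₀
  have hcompl : groupNormOn Sᶜ δ = 0 := groupNormOn_eq_zero fun j hj _ =>
    Pi.single_eq_of_ne (by rintro rfl; exact Finset.mem_compl.1 hj hj₀) _
  have heig := h δ hne (by rw [hcompl]; exact mul_nonneg (by norm_num) (groupNormOn_nonneg _ _))
  have hnorm : ∑ t, ∑ j ∈ S, δ t j ^ 2 = T := by simp [hδ, Pi.single_apply, hj₀]
  have hquad : quadForm (gram x) (Pi.single j₀ 1) ≤ X ^ 2 := by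
    rw [quadForm_gram]
    refine (empMean_mono fun i => ?_).trans (empMean_const_le (sq_nonneg X))
    simpa [Pi.single_apply] using sq_le_sq' (abs_le.1 (hX i j₀)).1 (abs_le.1 (hX i j₀)).2
  simp_rw [hnorm, hδ, Finset.sum_const, Finset.card_univ, Fintype.card_fin, nsmul_eq_mul] at heig
  rw [mul_div_cancel_left₀ _ hTpos.ne'] at heig
  exact le_of_sq_le_sq (heig.trans hquad) hX0

variable {d : Fin n → Fin (T + 1)} {γs γt γh γ : Coef T p}

lemma IsGroupLasso.lossBregman_le {lam κ β : ℝ} (h : IsGroupLasso x d lam γt) (hlam : 0 ≤ lam)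
    (hκ : 0 < κ) (hRE : IsRestrictedEigBound T (gram x) (groupSupport γs) κ)
    (hD : |lossDeriv x d γs (γt - γs)| ≤ β * √(predSq x (γt - γs))) :
    lossBregman x γs (γt - γs) ≤
      (lam * √(groupSupport γs).card / κ + β) * √(predSq x (γt - γs)) := by
  have hopt := h γs
  have hexp := loss_add x d γs (γt - γs)
  rw [add_sub_cancel] at hexp
  have hnorm : groupNorm γs - groupNorm γt ≤
      √(groupSupport γs).card / κ * √(predSq x (γt - γs)) := by
    refine (groupNorm_sub_groupNorm_le γs γt).trans ?_
    rcases le_or_gt (groupNormOn (groupSupport γs)ᶜ (γt - γs))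
      (4 * groupNormOn (groupSupport γs) (γt - γs)) with hcone | hcone
    · exact (sub_le_self _ (groupNormOn_nonneg _ _)).trans (hRE.groupNormOn_le hκ hcone)
    · have := groupNormOn_nonneg (groupSupport γs) (γt - γs)
      exact (by linarith : _ ≤ (0 : ℝ)).trans (by positivity)
  have hpen := mul_le_mul_of_nonneg_left hnorm hlam
  rw [← mul_assoc, ← mul_div_assoc] at hpen
  linarith [(abs_le.1 hD).1]

lemma IsRefit.lossBregman_le {S : Finset (Fin p)} (h : IsRefit x d S γh) (hγ : groupSupport γ ⊆ S)
    (γs : Coef T p) :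
    lossBregman x γs (γh - γs) ≤
      lossBregman x γs (γ - γs) + lossDeriv x d γs (γ - γs) - lossDeriv x d γs (γh - γs) := by
  have hopt := h.2 γ hγ
  have hexp := loss_add x d γs (γ - γs)
  have hexp' := loss_add x d γs (γh - γs)
  rw [add_sub_cancel] at hexp hexp'
  linarith

end BasicInequalities

section DeterministicBound

variable {n p T : ℕ} {x : Fin n → Fin p → ℝ}

/-- The loss is strongly convex around `γ`, with modulus `c` and up to prediction norm `R`, in the
directions supported in `S`. -/
def StronglyConvexNear (x : Fin n → Fin p → ℝ) (γ : Coef T p) (S : Finset (Fin p)) (c R : ℝ) :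
    Prop :=
  ∀ δ : Coef T p, groupSupport δ ⊆ S → √(predSq x δ) ≤ R → c * predSq x δ ≤ lossBregman x γ δ

-- Otherwise shrink `δ` to a direction of prediction norm in `(r, R]`; by convexity the divergence
-- shrinks at least proportionally.
lemma StronglyConvexNear.sqrt_predSq_le {γ : Coef T p} {S : Finset (Fin p)} {c R u v r : ℝ}
    (h : StronglyConvexNear x γ S c R) {δ : Coef T p} (hδ : groupSupport δ ⊆ S) (hv : 0 ≤ v)
    (hle : lossBregman x γ δ ≤ u * √(predSq x δ) + v) (hr0 : 0 ≤ r) (hrR : r < R)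
    (hr : ∀ q, r < q → u * q + v < c * q ^ 2) : √(predSq x δ) ≤ r := by
  by_contra! hlt
  set q := √(predSq x δ)
  have hq0 : 0 < q := hr0.trans_lt hlt
  set q' := min q R
  have hrq' : r < q' := lt_min hlt hrR
  set τ := q' / q
  have hτ0 : 0 ≤ τ := div_nonneg (hr0.trans hrq'.le) hq0.le
  have hτ1 : τ ≤ 1 := (div_le_one hq0).2 (min_le_left _ _)
  have hτq : τ * q = q' := div_mul_cancel₀ _ hq0.ne'
  have hnorm : √(predSq x (τ • δ)) = q' := by
    rw [predSq_smul, Real.sqrt_mul (sq_nonneg _), Real.sqrt_sq hτ0, hτq]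
  have hlower := h (τ • δ) ((groupSupport_smul_subset τ δ).trans hδ)
    (hnorm.trans_le (min_le_right _ _))
  rw [← Real.sq_sqrt (predSq_nonneg x (τ • δ)), hnorm] at hlower
  have hupper : lossBregman x γ (τ • δ) ≤ u * q' + v :=
    calc lossBregman x γ (τ • δ) ≤ τ * lossBregman x γ δ := lossBregman_smul_le x γ δ hτ0 hτ1
      _ ≤ τ * (u * q + v) := mul_le_mul_of_nonneg_left hle hτ0
      _ = u * (τ * q) + τ * v := by ring
      _ ≤ u * q' + v := by rw [hτq]; linarith [mul_le_of_le_one_left hv hτ1]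
  linarith [hr q' hrq']

-- With `ρ = Λ / c` as unit, the first inequality bounds the prediction norm of `δt` by `7 / 4`, and
-- then the second bounds that of `δh` by `11 / 4`, the positive root of `q² = q + 11 / 4 * 7 / 4`.
lemma StronglyConvexNear.sqrt_predSq_le_of_basic_inequalities {γ δt δh : Coef T p}
    {S : Finset (Fin p)} {c R Λ : ℝ} (h : StronglyConvexNear x γ S c R) (hc : 0 < c) (hΛ : 0 < Λ)
    (hR : 3 * Λ ≤ c * R) (hδt : groupSupport δt ⊆ S) (hδh : groupSupport δh ⊆ S)
    (hBt : lossBregman x γ δt ≤ 7 / 4 * Λ * √(predSq x δt))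
    (hBh : lossBregman x γ δh ≤
      lossBregman x γ δt + Λ * √(predSq x δt) + Λ * √(predSq x δh)) :
    √(predSq x δh) ≤ R := by
  obtain ⟨ρ, rfl⟩ : ∃ ρ, Λ = c * ρ := ⟨Λ / c, (mul_div_cancel₀ _ hc.ne').symm⟩
  have hρ : 0 < ρ := pos_of_mul_pos_right hΛ hc.le
  have hρR : 3 * ρ ≤ R := le_of_mul_le_mul_left (by linarith) hc
  have ht : √(predSq x δt) ≤ 7 / 4 * ρ := by
    refine h.sqrt_predSq_le (u := 7 / 4 * (c * ρ)) (v := 0) hδt le_rfl (by linarith)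
      (by positivity) (by linarith) fun q hq => ?_
    have := mul_pos (mul_pos hc (by linarith : 0 < q)) (sub_pos.2 hq)
    nlinarith
  have hh : √(predSq x δh) ≤ 11 / 4 * ρ := by
    refine h.sqrt_predSq_le (u := c * ρ) (v := 11 / 4 * (c * ρ) * (7 / 4 * ρ)) hδh (by positivity)
      (by linarith [mul_le_mul_of_nonneg_left ht hΛ.le]) (by positivity) (by linarith)
      fun q hq => ?_
    have := mul_pos (mul_pos hc (sub_pos.2 hq)) (by linarith : 0 < q + 7 / 4 * ρ)
    nlinarith
  linarith

variable {d : Fin n → Fin (T + 1)} {pr : Fin n → Fin (T + 1) → ℝ} {γs γt γh : Coef T p}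
  {S Shat : Finset (Fin p)} {s : ℕ} {X lam pmin b κ A : ℝ}

lemma pow_sub_le_sq_of_overlap {q : Fin (T + 1) → ℝ} (hq : ∀ t, pmin ≤ q t) (hq1 : ∑ t, q t = 1)
    (hT : 0 < T) (hb0 : 0 ≤ b) (hb : b < pmin) : (pmin - b) ^ (T + 1) ≤ pmin ^ 2 := by
  have hpmin : 0 < pmin := hb0.trans_lt hb
  have hpmin1 : pmin ≤ 1 := hq1 ▸ (hq 0).trans
    (Finset.single_le_sum (fun t _ => hpmin.le.trans (hq t)) (Finset.mem_univ 0))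
  calc (pmin - b) ^ (T + 1) ≤ pmin ^ (T + 1) := pow_le_pow_left₀ (sub_pos.2 hb).le (by linarith) _
    _ ≤ pmin ^ 2 := pow_le_pow_of_le_one hpmin.le hpmin1 (by omega)

lemma RateConditions.stronglyConvexNear
    (h : RateConditions T s S.card X lam pmin b κ (sparseEigMin (gram x) S) A) (hT : 0 < T)
    (hX0 : 0 ≤ X) (hX : ∀ i j, |x i j| ≤ X) (hlam : 0 ≤ lam) (hpr : ∀ i t, pmin ≤ pr i t)
    (hpr1 : ∀ i, ∑ t, pr i t = 1) (hb0 : 0 ≤ b)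
    (hb : ∀ t : Fin T, propError x pr γs t.succ ≤ b) :
    StronglyConvexNear x γs S ((pmin - b) ^ (T + 1) / 4) (RM T s lam pmin b κ 2) := by
  intro δ hδ hδR
  rcases isEmpty_or_nonempty (Fin n) with _ | ⟨⟨i₀⟩⟩
  · simp [predSq, lossBregman, empMean]
  have hφ := h.phi_pos
  have hpmin : 0 < pmin := hb0.trans_lt h.b_lt
  have hc2 := pow_sub_le_sq_of_overlap (hpr i₀) (hpr1 i₀) hT hb0 h.b_lt
  have hcR := le_mul_RM_two (s := s) hT hpmin hb0 h.b_lt hlam h.kappa_pos.le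
  have hLR := h.RM_two_mul_le hT hX0 hlam hb0
  set L := X * √S.card / sparseEigMin (gram x) S
  set c := (pmin - b) ^ (T + 1)
  set R := RM T s lam pmin b κ 2
  have hc0 : 0 < c := pow_pos (sub_pos.2 h.b_lt) _
  have hL0 : 0 ≤ L := by positivity
  have hbias : L * totalError x pr γs ≤ c / 64 := by
    have hℓ : 0 ≤ lam * √s / κ := div_nonneg (by positivity) h.kappa_pos.le
    have hbL : L * (16 * (b * √T)) ≤ L * (c * R) :=
      mul_le_mul_of_nonneg_left (by linarith) hL0
    linarith [mul_le_mul_of_nonneg_left (totalError_le hb0 hb) hL0,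
      mul_le_mul_of_nonneg_left hLR hc0.le]
  refine le_trans ?_ (le_lossBregman hpmin.le hpr hpr1 γs (sqrt_sum_sq_index_le hX0 hX hφ hδ)
    ((mul_le_mul_of_nonneg_left hδR hL0).trans hLR))
  exact mul_le_mul_of_nonneg_right (by linarith) (predSq_nonneg x δ)

lemma abs_lossDeriv_le_of_noiseBound (hX : κ ≤ X) (hκ : 0 < κ) (hlam : 0 ≤ lam) (hb0 : 0 ≤ b)
    (hb : ∀ t : Fin T, propError x pr γs t.succ ≤ b) {k : ℕ}
    (hν : NoiseBound x d pr k (3 / 4 * lam * √s / X)) {δ : Coef T p}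
    (hδ : (groupSupport δ).card ≤ k) :
    |lossDeriv x d γs δ| ≤ (b * √T + 3 / 4 * (lam * √s / κ)) * √(predSq x δ) := by
  have hνκ : 3 / 4 * lam * √s / X ≤ 3 / 4 * (lam * √s / κ) :=
    calc 3 / 4 * lam * √s / X ≤ 3 / 4 * lam * √s / κ := by gcongr
      _ = 3 / 4 * (lam * √s / κ) := by ring
  exact (abs_lossDeriv_le hν γs hδ).trans
    (mul_le_mul_of_nonneg_right (add_le_add (totalError_le hb0 hb) hνκ) (Real.sqrt_nonneg _))

lemma sqrt_predSq_refit_le (hT : 0 < T) (hX0 : 0 ≤ X) (hX : ∀ i j, |x i j| ≤ X) (hlam : 0 < lam)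
    (hpr : ∀ i t, pmin ≤ pr i t) (hpr1 : ∀ i, ∑ t, pr i t = 1)
    (hν : NoiseBound x d pr (2 * (groupSupport γs).card)
      (3 / 4 * lam * √(groupSupport γs).card / X))
    (hb0 : 0 ≤ b) (hb : ∀ t : Fin T, propError x pr γs t.succ ≤ b)
    (hRE : IsRestrictedEigBound T (gram x) (groupSupport γs) κ) (hs : (groupSupport γs).Nonempty)
    (hrate : RateConditions T (groupSupport γs).card (Shat ∪ groupSupport γs).card X lam pmin b κ
      (sparseEigMin (gram x) (Shat ∪ groupSupport γs)) A)
    (hlasso : IsGroupLasso x d lam γt) (hsupp : groupSupport γt ⊆ Shat)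
    (hcard : Shat.card ≤ (groupSupport γs).card) (hrefit : IsRefit x d Shat γh) :
    √(predSq x (γh - γs)) ≤ RM T (groupSupport γs).card lam pmin b κ 2 := by
  have hκ := hrate.kappa_pos
  have hκX : κ ≤ X := hRE.le_of_abs_le hT hs hX0 hX
  have hsub : ∀ {γ : Coef T p}, groupSupport γ ⊆ Shat →
      groupSupport (γ - γs) ⊆ Shat ∪ groupSupport γs := fun hγ =>
    (groupSupport_sub_subset _ _).trans (Finset.union_subset_union_left hγ)
  have hD : ∀ {γ : Coef T p}, groupSupport γ ⊆ Shat →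
      |lossDeriv x d γs (γ - γs)| ≤
        (b * √T + 3 / 4 * (lam * √(groupSupport γs).card / κ)) * √(predSq x (γ - γs)) := fun hγ =>
    abs_lossDeriv_le_of_noiseBound hκX hκ hlam.le hb0 hb hν <|
      (Finset.card_le_card (hsub hγ)).trans <| (Finset.card_union_le _ _).trans (by omega)
  have hBt := hlasso.lossBregman_le hlam.le hκ hRE (hD hsupp)
  have hBh := hrefit.lossBregman_le hsupp γs
  have hDt := (abs_le.1 (hD hsupp)).2
  have hDh := (abs_le.1 (hD hrefit.1)).1
  have hcR := le_mul_RM_two (s := (groupSupport γs).card) hT (hb0.trans_lt hrate.b_lt) hb0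
    hrate.b_lt hlam.le hκ.le
  have hℓ : 0 < lam * √(groupSupport γs).card / κ :=
    div_pos (mul_pos hlam (Real.sqrt_pos.2 (by exact_mod_cast hs.card_pos))) hκ
  have hβ : 0 ≤ b * √T := by positivity
  set ℓ := lam * √(groupSupport γs).card / κ
  have hslack : ∀ γ : Coef T p, 0 ≤ (1 / 4 * ℓ) * √(predSq x (γ - γs)) ∧
      0 ≤ (b * √T) * √(predSq x (γ - γs)) := fun γ =>
    ⟨by positivity, by positivity⟩
  refine (hrate.stronglyConvexNear hT hX0 hX hlam.le hpr hpr1 hb0 hb)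
    |>.sqrt_predSq_le_of_basic_inequalities (Λ := ℓ + b * √T)
      (div_pos (pow_pos (sub_pos.2 hrate.b_lt) _) (by norm_num)) (by positivity) (by linarith)
      (hsub hsupp) (hsub hrefit.1) ?_ ?_
  · linarith [hslack γt]
  · linarith [hslack γt, hslack γh]

theorem refitBounds_of_noiseBound (hn : 0 < n) (hT : 0 < T) (hX : ∀ i j, |x i j| ≤ X)
    (hlam : 0 < X → 0 < lam) (hpr : ∀ i t, pmin ≤ pr i t) (hpr1 : ∀ i, ∑ t, pr i t = 1)
    (hν : (groupSupport γs).Nonempty → 0 < X → NoiseBound x d pr (2 * (groupSupport γs).card)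
      (3 / 4 * lam * √(groupSupport γs).card / X)) :
    RefitBounds x d pr γs X lam pmin b κ A Shat γt γh := by
  intro hb hRE hrate hlasso hsupp hcard hrefit
  have hb0 : 0 ≤ b := (Real.sqrt_nonneg _).trans (hb ⟨0, hT⟩)
  have hs : (groupSupport γs).Nonempty := Finset.card_pos.1 <| by
    have := (nonempty_of_sparseEigMin_pos hrate.phi_pos).card_pos.trans_le
      (Finset.card_union_le Shat (groupSupport γs))
    omega
  have hX0 : 0 ≤ X := hs.elim fun j _ => (abs_nonneg _).trans (hX ⟨0, hn⟩ j)
  have hXpos : 0 < X := hrate.kappa_pos.trans_le (hRE.le_of_abs_le hT hs hX0 hX)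
  have hlam0 : 0 < lam := hlam hXpos
  have hsub : groupSupport (γh - γs) ⊆ Shat ∪ groupSupport γs :=
    (groupSupport_sub_subset _ _).trans (Finset.union_subset_union_left hrefit.1)
  have hnorm := sqrt_predSq_refit_le hT hX0 hX hlam0 hpr hpr1 (hν hs hXpos) hb0 hb hRE hs hrate
    hlasso hsupp hcard hrefit
  have hL := hrate.RM_two_mul_le hT hX0 hlam0.le hb0
  have hR'' : ∀ R', √(predSq x (γh - γs)) ≤
      RM'' T pmin b A (RM T (groupSupport γs).card lam pmin b κ A) R' := fun R' => by
    refine hnorm.trans (le_trans ?_ (le_max_left _ _))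
    rw [RM_eq_mul _ _ _ _ _ _ A]
    exact le_mul_of_one_le_left ((Real.sqrt_nonneg _).trans hnorm)
      (by linarith [hrate.two_lt hX0 hlam0.le hb0])
  refine ⟨fun t => ?_, fun t => ?_⟩
  · have herr := propError_add_le (γ := γs) (δ := γh - γs) (pr := pr) (fun i =>
      (sqrt_sum_sq_index_le hX0 hX hrate.phi_pos hsub i).trans
        ((mul_le_mul_of_nonneg_left hnorm
          (div_nonneg (by positivity) hrate.phi_pos.le)).trans hL)) t.succ
    rw [add_sub_cancel] at herr
    exact herr.trans (add_le_add (hR'' _) (hb t))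
  · exact (sum_abs_le_sqrt_predSq hrate.phi_pos hsub t).trans
      (mul_le_mul_of_nonneg_left (hR'' _) (div_nonneg (Real.sqrt_nonneg _) hrate.phi_pos.le))

end DeterministicBound

section Noise

variable {n k p T : ℕ}

lemma sum_mul_exp_noise_le {w : Fin (T + 1) → ℝ} (hw : w ∈ stdSimplex ℝ (Fin (T + 1)))
    (v : Fin T → ℝ) :
    ∑ r, w r * Real.exp (∑ t : Fin T, ((if r = t.succ then 1 else 0) - w t.succ) * v t) ≤
      Real.exp ((∑ t, v t ^ 2) / 4) := by
  have hexp (r : Fin (T + 1)) :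
      ∑ t : Fin T, ((if r = t.succ then 1 else 0) - w t.succ) * v t =
        withBaseline v r - ∑ t, w t * withBaseline v t := by
    rw [sum_mul_withBaseline, withBaseline_apply, ← Finset.sum_sub_distrib]
    exact Finset.sum_congr rfl fun t _ => sub_mul _ _ _
  simp_rw [hexp]
  refine (sum_mul_exp_sub_mean_le hw (withBaseline_sub_sq_le v)).trans_eq ?_
  congr 1; ring

lemma sum_prod_mul_exp_noise_le {pr : Fin n → Fin (T + 1) → ℝ}
    (hpr : ∀ i, pr i ∈ stdSimplex ℝ (Fin (T + 1))) (v : Fin n → Fin T → ℝ) :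
    ∑ d : Fin n → Fin (T + 1), (∏ i, pr i (d i)) * Real.exp (∑ i, ∑ t : Fin T,
        ((if d i = t.succ then 1 else 0) - pr i t.succ) * v i t) ≤
      Real.exp ((∑ i, ∑ t, v i t ^ 2) / 4) := by
  simp_rw [Real.exp_sum Finset.univ (fun _ => ∑ _ : Fin T, _), ← Finset.prod_mul_distrib]
  rw [← Fintype.piFinset_univ, ← Finset.prod_univ_sum (fun _ => Finset.univ) (fun i r =>
    pr i r * Real.exp (∑ t : Fin T, ((if r = t.succ then 1 else 0) - pr i t.succ) * v i t)),
    Finset.sum_div, Real.exp_sum]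
  exact Finset.prod_le_prod
    (fun i _ => Finset.sum_nonneg fun r _ => mul_nonneg ((hpr i).1 r) (Real.exp_pos _).le)
    fun i _ => sum_mul_exp_noise_le (hpr i) (v i)

lemma exists_orthonormal_coords (x : Fin n → Fin k → ℝ) :
    ∃ K ≤ k, ∃ (e : Fin K → Fin n → ℝ) (a : Fin k → Fin K → ℝ),
      (∀ l m, ∑ i, e l i * e m i = if l = m then 1 else 0) ∧
      ∀ i j, x i j = ∑ l, a j l * e l i := by
  let col : Fin k → EuclideanSpace ℝ (Fin n) := fun j => WithLp.toLp 2 fun i => x i j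
  let V := Submodule.span ℝ (Set.range col)
  let B := stdOrthonormalBasis ℝ V
  refine ⟨Module.finrank ℝ V, (finrank_range_le_card col).trans_eq (Fintype.card_fin k),
    fun l i => (B l : EuclideanSpace ℝ (Fin n)) i,
    fun j l => inner ℝ (B l) ⟨col j, Submodule.subset_span ⟨j, rfl⟩⟩, fun l m => ?_,
    fun i j => ?_⟩
  · rw [← orthonormal_iff_ite.1 B.orthonormal l m, Submodule.coe_inner, PiLp.inner_apply]
    exact Finset.sum_congr rfl fun i _ => by simp [mul_comm]
  · have hcol := congrArg (fun v : V => (v : EuclideanSpace ℝ (Fin n)) i)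
      (B.sum_repr' ⟨col j, Submodule.subset_span ⟨j, rfl⟩⟩)
    simp only [col, Submodule.coe_sum, Submodule.coe_smul] at hcol
    simpa using hcol.symm

lemma sum_sq_sum_mul_of_orthonormal {ι κ : Type*} [Fintype ι] [Fintype κ] [DecidableEq κ]
    {e : κ → ι → ℝ} (he : ∀ l m, ∑ i, e l i * e m i = if l = m then 1 else 0) (c : κ → ℝ) :
    ∑ i, (∑ l, c l * e l i) ^ 2 = ∑ l, c l ^ 2 := by
  have hexpand (i : ι) : (∑ l, c l * e l i) ^ 2 = ∑ l, ∑ m, c l * c m * (e l i * e m i) := by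
    rw [sq, Finset.sum_mul_sum]
    exact Finset.sum_congr rfl fun l _ => Finset.sum_congr rfl fun m _ => by ring
  simp_rw [hexpand]
  rw [Finset.sum_comm]
  refine Finset.sum_congr rfl fun l _ => ?_
  rw [Finset.sum_comm]
  simp_rw [← Finset.mul_sum, he]
  simp [sq]

/-- The coordinates along the vectors `e l` of the noise in each of the nonbaseline treatments. -/
def noiseCoord {K : ℕ} (e : Fin K → Fin n → ℝ) (pr : Fin n → Fin (T + 1) → ℝ)
    (d : Fin n → Fin (T + 1)) (q : Fin T × Fin K) : ℝ :=
  ∑ i, ((if d i = q.1.succ then 1 else 0) - pr i q.1.succ) * e q.2 i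

section Coordinates

variable {K : ℕ} {e : Fin K → Fin n → ℝ} {pr : Fin n → Fin (T + 1) → ℝ}

lemma sum_mul_noiseCoord (c : Fin T × Fin K → ℝ) (d : Fin n → Fin (T + 1)) :
    ∑ q, c q * noiseCoord e pr d q = ∑ i, ∑ t : Fin T,
      ((if d i = t.succ then 1 else 0) - pr i t.succ) * ∑ l, c (t, l) * e l i := by
  simp_rw [noiseCoord, Fintype.sum_prod_type, Finset.mul_sum]
  rw [eq_comm, Finset.sum_comm]
  refine Finset.sum_congr rfl fun t _ => ?_
  rw [Finset.sum_comm]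
  exact Finset.sum_congr rfl fun l _ => Finset.sum_congr rfl fun i _ => mul_left_comm _ _ _

variable (he : ∀ l m, ∑ i, e l i * e m i = if l = m then 1 else 0)
include he

lemma sum_prod_mul_exp_sq_noiseCoord_le (hpr : ∀ i, pr i ∈ stdSimplex ℝ (Fin (T + 1))) :
    ∑ d : Fin n → Fin (T + 1), (∏ i, pr i (d i)) *
      Real.exp ((∑ q, noiseCoord (T := T) e pr d q ^ 2) / 2) ≤ √2 ^ (T * K) := by
  have hmgf (c : Fin T × Fin K → ℝ) :
      ∑ d, (∏ i, pr i (d i)) * Real.exp (∑ q, c q * noiseCoord e pr d q) ≤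
        Real.exp ((∑ q, c q ^ 2) / 4) := by
    simp_rw [sum_mul_noiseCoord]
    refine (sum_prod_mul_exp_noise_le hpr _).trans_eq ?_
    rw [Finset.sum_comm, Fintype.sum_prod_type]
    simp_rw [sum_sq_sum_mul_of_orthonormal he]
  simpa only [Fintype.card_prod, Fintype.card_fin] using sum_mul_exp_sq_le hmgf

lemma abs_noise_le_of_orthonormal {x : Fin n → Fin k → ℝ} {a : Fin k → Fin K → ℝ}
    (hx : ∀ i j, x i j = ∑ l, a j l * e l i) (d : Fin n → Fin (T + 1)) (δ : Coef T k) :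
    |noise x d pr δ| ≤ √((∑ q, noiseCoord e pr d q ^ 2) / n) * √(predSq x δ) := by
  let c : Fin T × Fin K → ℝ := fun q => ∑ j, δ q.1 j * a j q.2
  have hindex (i : Fin n) (t : Fin T) : index x δ i t = ∑ l, c (t, l) * e l i := by
    simp_rw [index, hx, c, Finset.sum_mul]
    rw [Finset.sum_comm]
    exact Finset.sum_congr rfl fun l _ => Finset.sum_congr rfl fun j _ => by ring
  have hpred : predSq x δ = (∑ q, c q ^ 2) / n := by
    rw [predSq, empMean, Finset.sum_comm, Fintype.sum_prod_type]
    simp_rw [hindex, sum_sq_sum_mul_of_orthonormal he]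
  have hnoise : noise x d pr δ = (∑ q, noiseCoord e pr d q * c q) / n := by
    simp_rw [mul_comm _ (c _), sum_mul_noiseCoord, noise, empMean, hindex]
  rw [hpred, hnoise, abs_div, Nat.abs_cast, Real.sqrt_div' _ n.cast_nonneg,
    Real.sqrt_div' _ n.cast_nonneg, div_mul_div_comm, Real.mul_self_sqrt n.cast_nonneg]
  gcongr
  refine (Finset.abs_sum_le_sum_abs _ _).trans ?_
  simp_rw [abs_mul]
  exact sum_abs_mul_abs_le_sqrt_mul_sqrt _ _

end Coordinates

open Classical in
lemma sum_prod_mul_ite_lt_noise_le (x : Fin n → Fin k → ℝ)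
    {pr : Fin n → Fin (T + 1) → ℝ} (hpr : ∀ i, pr i ∈ stdSimplex ℝ (Fin (T + 1)))
    {ν : ℝ} (hν : 0 ≤ ν) :
    (∑ d : Fin n → Fin (T + 1), (∏ i, pr i (d i)) *
      if ∃ δ : Coef T k, ν * √(predSq x δ) < |noise x d pr δ| then 1 else 0) ≤
      √2 ^ (T * k) * Real.exp (-(n * ν ^ 2) / 2) := by
  obtain ⟨K, hK, e, a, he, hx⟩ := exists_orthonormal_coords x
  have hlarge (d : Fin n → Fin (T + 1))
      (hd : ∃ δ : Coef T k, ν * √(predSq x δ) < |noise x d pr δ|) :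
      n * ν ^ 2 ≤ ∑ q, noiseCoord (T := T) e pr d q ^ 2 := by
    obtain ⟨δ, hδ⟩ := hd
    have hlt := lt_of_mul_lt_mul_right (hδ.trans_le (abs_noise_le_of_orthonormal he hx d δ))
      (Real.sqrt_nonneg _)
    rw [mul_comm]
    exact mul_le_of_le_div₀ (Finset.sum_nonneg fun q _ => sq_nonneg _) n.cast_nonneg
      ((Real.lt_sqrt hν).1 hlt).le
  have hmarkov (d : Fin n → Fin (T + 1)) :
      (∏ i, pr i (d i)) * (if ∃ δ : Coef T k, ν * √(predSq x δ) < |noise x d pr δ|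
        then (1 : ℝ) else 0) ≤
      (∏ i, pr i (d i)) * Real.exp ((∑ q, noiseCoord (T := T) e pr d q ^ 2) / 2) *
        Real.exp (-(n * ν ^ 2) / 2) := by
    rw [mul_assoc, ← Real.exp_add]
    refine mul_le_mul_of_nonneg_left ?_ (Finset.prod_nonneg fun i _ => (hpr i).1 _)
    split_ifs with hd
    · exact Real.one_le_exp (by linarith [hlarge d hd])
    · exact (Real.exp_pos _).le
  refine (Finset.sum_le_sum fun d _ => hmarkov d).trans ?_
  rw [← Finset.sum_mul]
  refine mul_le_mul_of_nonneg_right ((sum_prod_mul_exp_sq_noiseCoord_le he hpr).trans ?_)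
    (Real.exp_pos _).le
  exact pow_le_pow_right₀ (Real.one_le_sqrt.2 one_le_two) (Nat.mul_le_mul_left T hK)

lemma exists_index_comp_eq (x : Fin n → Fin p → ℝ) {δ : Coef T p}
    (hδ : (groupSupport δ).card ≤ k) :
    δ = 0 ∨ ∃ (f : Fin k → Fin p) (δ' : Coef T k),
      index (fun i l => x i (f l)) δ' = index x δ := by
  classical
  rcases (groupSupport δ).eq_empty_or_nonempty with hempty | ⟨j₀, -⟩
  · refine .inl (funext₂ fun t j => eq_zero_of_notMem_groupSupport ?_ t)
    simp [hempty]
  obtain ⟨g⟩ : Nonempty (groupSupport δ ↪ Fin k) :=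
    Function.Embedding.nonempty_of_card_le (by simpa using hδ)
  let f : Fin k → Fin p := Function.extend g Subtype.val fun _ => j₀
  have hfg (j : groupSupport δ) : f (g j) = j := g.injective.extend_apply _ _ j
  refine .inr ⟨f, fun t l => ∑ j : groupSupport δ, if g j = l then δ t j else 0, ?_⟩
  ext i t
  calc ∑ l, x i (f l) * ∑ j : groupSupport δ, (if g j = l then δ t j else 0)
      = ∑ j : groupSupport δ, x i j * δ t j := by
        simp_rw [Finset.mul_sum]
        rw [Finset.sum_comm]
        exact Finset.sum_congr rfl fun j _ => by simp [hfg]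
    _ = ∑ j ∈ groupSupport δ, x i j * δ t j :=
        Finset.sum_coe_sort _ fun j => x i j * δ t j
    _ = ∑ j, x i j * δ t j :=
        (sum_eq_sum_of_groupSupport_subset (f := fun j u => x i j * u) subset_rfl t
          fun j => mul_zero _).symm

lemma noiseBound_of_forall {x : Fin n → Fin p → ℝ} {d : Fin n → Fin (T + 1)}
    {pr : Fin n → Fin (T + 1) → ℝ} {ν : ℝ}
    (h : ∀ (f : Fin k → Fin p) (δ : Coef T k),
      |noise (fun i l => x i (f l)) d pr δ| ≤ ν * √(predSq (fun i l => x i (f l)) δ)) :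
    NoiseBound x d pr k ν := by
  intro δ hδ
  rcases exists_index_comp_eq x hδ with rfl | ⟨f, δ', hδ'⟩
  · simp [noise, predSq, index, empMean]
  · simpa only [noise, predSq, hδ'] using h f δ'

end Noise

lemma sum_map_withDensity_apply {Ω Ω' ι : Type*} [MeasurableSpace Ω] [MeasurableSpace Ω']
    [Fintype ι] (μ : Measure Ω) (f : ι → Ω → ENNReal) {Φ : ι → Ω → Ω'}
    (hΦ : ∀ d, Measurable (Φ d)) {C : Set Ω'} (hC : MeasurableSet C) :
    (∑ d, (μ.withDensity (f d)).map (Φ d)) C =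
      ∑ d, ∫⁻ z, f d z * C.indicator 1 (Φ d z) ∂μ := by
  rw [Measure.coe_finsetSum, Finset.sum_apply]
  refine Finset.sum_congr rfl fun d _ => ?_
  rw [Measure.map_apply (hΦ d) hC, withDensity_apply _ (hΦ d hC),
    ← lintegral_indicator (hΦ d hC)]
  refine lintegral_congr fun z => ?_
  by_cases hz : Φ d z ∈ C <;> simp [hz]

lemma lintegral_pi_prod_eq_prod_lintegral {ι Ω : Type*} [Fintype ι] [MeasurableSpace Ω]
    (μ : ι → Measure Ω) [∀ i, IsProbabilityMeasure (μ i)] {g : ι → Ω → ENNReal}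
    (hg : ∀ i, Measurable (g i)) :
    ∫⁻ z, ∏ i, g i (z i) ∂Measure.pi μ = ∏ i, ∫⁻ z, g i z ∂μ i := by
  refine (lintegral_prod_eq_prod_lintegral_of_indepFun Finset.univ
    (fun i (z : ι → Ω) => g i (z i)) (iIndepFun_pi fun i => (hg i).aemeasurable)
    fun i => (hg i).comp (measurable_pi_apply i)).trans ?_
  exact Finset.prod_congr rfl fun i _ => (measurePreserving_eval μ i).lintegral_comp (hg i)

section Propensity

variable {E : Type*} [MeasurableSpace E] {T : ℕ} {P : Measure (E × Fin (T + 1))}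
  {pr : Fin (T + 1) → E → ℝ}

lemma measurableSet_snd_eq (t : Fin (T + 1)) : MeasurableSet {z : E × Fin (T + 1) | z.2 = t} :=
  measurable_snd (measurableSet_singleton t)

lemma IsPropensityScore.ae_nonneg (h : IsPropensityScore P pr) :
    ∀ᵐ z ∂P, ∀ t, 0 ≤ pr t z.1 := by
  refine ae_all_iff.2 fun t => ?_
  filter_upwards [(h t).2, condExp_nonneg (μ := P)
    (m := MeasurableSpace.comap Prod.fst inferInstance) (ae_of_all _ fun z =>
      Set.indicator_nonneg (s := {z : E × Fin (T + 1) | z.2 = t})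
        (fun _ _ => zero_le_one (α := ℝ)) z)] with z hz hnonneg
  exact hz ▸ hnonneg

variable [IsFiniteMeasure P]

lemma integrable_indicator_snd_eq (t : Fin (T + 1)) :
    Integrable (Set.indicator {z : E × Fin (T + 1) | z.2 = t} fun _ => (1 : ℝ)) P :=
  (integrable_const 1).indicator (measurableSet_snd_eq t)

lemma IsPropensityScore.ae_sum_eq_one (h : IsPropensityScore P pr) :
    ∀ᵐ z ∂P, ∑ t, pr t z.1 = 1 := by
  have hsum : ∑ t : Fin (T + 1),
      Set.indicator {z : E × Fin (T + 1) | z.2 = t} (fun _ => (1 : ℝ)) = fun _ => 1 := by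
    ext z
    simp [Finset.sum_apply, Set.indicator_apply]
  have hcond := condExp_finsetSum (s := Finset.univ) (μ := P)
    (fun (t : Fin (T + 1)) _ => integrable_indicator_snd_eq (E := E) t)
    (MeasurableSpace.comap Prod.fst inferInstance)
  rw [hsum, condExp_const measurable_fst.comap_le] at hcond
  filter_upwards [hcond, ae_all_iff.2 fun t => (h t).2] with z hz hpr
  rw [Finset.sum_apply] at hz
  simpa only [hpr] using hz.symm

lemma IsPropensityScore.ae_mem_stdSimplex (h : IsPropensityScore P pr) :
    ∀ᵐ z ∂P, (fun t => pr t z.1) ∈ stdSimplex ℝ (Fin (T + 1)) :=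
  h.ae_nonneg.and h.ae_sum_eq_one

lemma IsPropensityScore.measure_fst_preimage_inter (h : IsPropensityScore P pr) (t : Fin (T + 1))
    {s : Set E} (hs : MeasurableSet s) :
    P (Prod.fst ⁻¹' s ∩ {z | z.2 = t}) =
      ∫⁻ z in Prod.fst ⁻¹' s, ENNReal.ofReal (pr t z.1) ∂P := by
  have hm : MeasurableSpace.comap (Prod.fst : E × Fin (T + 1) → E) inferInstance ≤
      Prod.instMeasurableSpace := measurable_fst.comap_le
  have hcond := setIntegral_condExp (μ := P) (s := Prod.fst ⁻¹' s) hm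
    (integrable_indicator_snd_eq (E := E) t) ⟨s, hs, rfl⟩
  rw [setIntegral_congr_ae (measurable_fst hs) ((h t).2.mono fun z hz _ => hz),
    setIntegral_indicator (measurableSet_snd_eq t), setIntegral_const, smul_eq_mul,
    mul_one] at hcond
  have hint : Integrable (fun z : E × Fin (T + 1) => pr t z.1) P :=
    integrable_condExp.congr (h t).2
  rw [← ofReal_integral_eq_lintegral_ofReal hint.integrableOn
    (ae_restrict_of_ae (h.ae_nonneg.mono fun z hz => hz t)), hcond, ofReal_measureReal]

lemma IsPropensityScore.measure_eq_sum_lintegral (h : IsPropensityScore P pr)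
    {s : Set (E × Fin (T + 1))} (hs : MeasurableSet s) :
    P s = ∑ t, ∫⁻ z, ENNReal.ofReal (pr t z.1) * s.indicator 1 (z.1, t) ∂P := by
  have hslice (t : Fin (T + 1)) : MeasurableSet {x : E | (x, t) ∈ s} :=
    measurable_prodMk_right hs
  have hunion : s = ⋃ t : Fin (T + 1), Prod.fst ⁻¹' {x : E | (x, t) ∈ s} ∩ {z | z.2 = t} := by
    ext; simp
  conv_lhs => rw [hunion]
  rw [measure_iUnion (fun t r htr => Set.disjoint_left.2 fun z hz hz' =>
      htr (hz.2.symm.trans hz'.2))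
    fun t => (measurable_fst (hslice t)).inter (measurableSet_snd_eq t), tsum_fintype]
  refine Finset.sum_congr rfl fun t _ => ?_
  rw [h.measure_fst_preimage_inter t (hslice t), ← lintegral_indicator (measurable_fst (hslice t))]
  refine lintegral_congr fun z => ?_
  by_cases hz : (z.1, t) ∈ s <;> simp [hz]

end Propensity

section Sample

variable {E : Type*} [MeasurableSpace E] {T n : ℕ} {P : Measure (E × Fin (T + 1))}
  {pr : Fin (T + 1) → E → ℝ}

/-- The sample `z` with its treatments replaced by `d`. -/
def withTreatments (d : Fin n → Fin (T + 1)) (z : Fin n → E × Fin (T + 1)) (i : Fin n) :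
    E × Fin (T + 1) := ((z i).1, d i)

lemma measurable_withTreatments (d : Fin n → Fin (T + 1)) :
    Measurable (withTreatments (E := E) d) :=
  measurable_pi_lambda _ fun i =>
    (measurable_fst.comp (measurable_pi_apply i)).prodMk measurable_const

variable [IsProbabilityMeasure P]

lemma IsPropensityScore.pi_univ_pi (h : IsPropensityScore P pr) {s : Fin n → Set (E × Fin (T + 1))}
    (hs : ∀ i, MeasurableSet (s i)) :
    ∑ d : Fin n → Fin (T + 1), ∫⁻ z, (∏ i, ENNReal.ofReal (pr (d i) (z i).1)) *
        (Set.univ.pi s).indicator 1 (withTreatments d z) ∂Measure.pi (fun _ : Fin n => P) =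
      ∏ i, P (s i) := by
  let g : Fin n → Fin (T + 1) → E × Fin (T + 1) → ENNReal := fun i t z =>
    ENNReal.ofReal (pr t z.1) * (s i).indicator 1 (z.1, t)
  have hg (i : Fin n) (t : Fin (T + 1)) : Measurable (g i t) :=
    ((h t).1.comp measurable_fst).ennreal_ofReal.mul
      ((measurable_one.indicator (hs i)).comp (measurable_fst.prodMk measurable_const))
  have hprod (d : Fin n → Fin (T + 1)) (z : Fin n → E × Fin (T + 1)) :
      (∏ i, ENNReal.ofReal (pr (d i) (z i).1)) *
        (Set.univ.pi s).indicator 1 (withTreatments d z) = ∏ i, g i (d i) (z i) := by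
    rw [Finset.prod_mul_distrib, ← Finset.coe_univ, Set.indicator_pi_one_apply]
    rfl
  simp_rw [hprod, fun d : Fin n → Fin (T + 1) =>
    lintegral_pi_prod_eq_prod_lintegral (fun _ => P) fun i => hg i (d i)]
  rw [← Fintype.piFinset_univ,
    ← Finset.prod_univ_sum (fun _ => Finset.univ) fun i t => ∫⁻ z, g i t z ∂P]
  exact Finset.prod_congr rfl fun i _ => (h.measure_eq_sum_lintegral (hs i)).symm

lemma IsPropensityScore.pi_eq_sum_lintegral (h : IsPropensityScore P pr)
    {B : Set (Fin n → E × Fin (T + 1))} (hB : MeasurableSet B) :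
    Measure.pi (fun _ : Fin n => P) B = ∑ d : Fin n → Fin (T + 1),
      ∫⁻ z, (∏ i, ENNReal.ofReal (pr (d i) (z i).1)) * B.indicator 1 (withTreatments d z)
        ∂Measure.pi fun _ : Fin n => P := by
  rw [← sum_map_withDensity_apply _ _ measurable_withTreatments hB]
  congr 1
  refine Measure.pi_eq fun s hs => ?_
  rw [sum_map_withDensity_apply _ _ measurable_withTreatments (.univ_pi hs), h.pi_univ_pi hs]

end Sample

section NoiseProbability

variable {n k T : ℕ}

lemma continuous_index (x : Fin n → Fin k → ℝ) (i : Fin n) (t : Fin T) :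
    Continuous fun δ : Coef T k => index x δ i t := by
  unfold index; fun_prop

lemma continuous_predSq (x : Fin n → Fin k → ℝ) :
    Continuous fun δ : Coef T k => predSq x δ := by
  unfold predSq empMean
  have := continuous_index (T := T) x
  fun_prop

lemma continuous_noise (x : Fin n → Fin k → ℝ) (d : Fin n → Fin (T + 1))
    (pr : Fin n → Fin (T + 1) → ℝ) : Continuous fun δ : Coef T k => noise x d pr δ := by
  unfold noise empMean
  have := continuous_index (T := T) x
  fun_prop

lemma exists_lt_noise_iff_exists_rat (x : Fin n → Fin k → ℝ) (d : Fin n → Fin (T + 1))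
    (pr : Fin n → Fin (T + 1) → ℝ) (ν : ℝ) :
    (∃ δ : Coef T k, ν * √(predSq x δ) < |noise x d pr δ|) ↔
      ∃ q : Fin T → Fin k → ℚ, ν * √(predSq x fun t l => (q t l : ℝ)) <
        |noise x d pr fun t l => (q t l : ℝ)| := by
  refine ⟨fun h => ?_, fun ⟨q, hq⟩ => ⟨_, hq⟩⟩
  have hdense : DenseRange (Pi.map fun _ : Fin T => Pi.map fun _ : Fin k => ((↑) : ℚ → ℝ)) :=
    .piMap fun _ => .piMap fun _ => Rat.denseRange_cast
  have hopen : IsOpen {δ : Coef T k | ν * √(predSq x δ) < |noise x d pr δ|} :=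
    isOpen_lt ((continuous_predSq x).sqrt.const_mul ν) (continuous_noise x d pr).abs
  exact hdense.exists_mem_open hopen h

variable {E : Type*} [MeasurableSpace E]

/-- The samples in which the noise exceeds `ν` times the prediction norm in some direction. -/
def largeNoise (n : ℕ) (x : E → Fin k → ℝ) (pr : Fin (T + 1) → E → ℝ) (ν : ℝ) :
    Set (Fin n → E × Fin (T + 1)) :=
  {z | ∃ δ : Coef T k, ν * √(predSq (fun i => x (z i).1) δ) <
    |noise (fun i => x (z i).1) (fun i => (z i).2) (fun i t => pr t (z i).1) δ|}

lemma measurable_index {x : E → Fin k → ℝ} (hx : Measurable x) (δ : Coef T k) (i : Fin n)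
    (t : Fin T) : Measurable fun z : Fin n → E × Fin (T + 1) =>
      index (fun i => x (z i).1) δ i t := by
  unfold index
  fun_prop

lemma measurable_noise {x : E → Fin k → ℝ} (hx : Measurable x)
    {pr : Fin (T + 1) → E → ℝ} (hpr : ∀ t, Measurable (pr t)) (δ : Coef T k) :
    Measurable fun z : Fin n → E × Fin (T + 1) =>
      noise (fun i => x (z i).1) (fun i => (z i).2) (fun i t => pr t (z i).1) δ := by
  have hind (i : Fin n) (t : Fin T) : Measurable fun z : Fin n → E × Fin (T + 1) =>
      if (z i).2 = t.succ then (1 : ℝ) else 0 :=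
    (measurable_of_finite fun r : Fin (T + 1) => if r = t.succ then (1 : ℝ) else 0).comp
      (measurable_snd.comp (measurable_pi_apply i))
  have := measurable_index (n := n) hx δ
  unfold noise empMean
  fun_prop

lemma measurableSet_largeNoise {x : E → Fin k → ℝ} (hx : Measurable x)
    {pr : Fin (T + 1) → E → ℝ} (hpr : ∀ t, Measurable (pr t)) (ν : ℝ) :
    MeasurableSet (largeNoise n x pr ν) := by
  simp_rw [largeNoise, exists_lt_noise_iff_exists_rat]
  rw [Set.ofPred_exists]
  refine MeasurableSet.iUnion fun q => measurableSet_lt ?_ (measurable_noise hx hpr _).abs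
  have := measurable_index (n := n) hx fun t l => (q t l : ℝ)
  unfold predSq empMean
  fun_prop

lemma measure_largeNoise_le {P : Measure (E × Fin (T + 1))} [IsProbabilityMeasure P]
    {x : E → Fin k → ℝ} (hx : Measurable x) {pr : Fin (T + 1) → E → ℝ}
    (hpr : IsPropensityScore P pr) {ν : ℝ} (hν : 0 ≤ ν) :
    Measure.pi (fun _ : Fin n => P) (largeNoise n x pr ν) ≤
      ENNReal.ofReal (√2 ^ (T * k) * Real.exp (-(n * ν ^ 2) / 2)) := by
  classical
  have hmeas := measurableSet_largeNoise (n := n) hx (fun t => (hpr t).1) ν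
  rw [hpr.pi_eq_sum_lintegral hmeas, ← lintegral_finsetSum]
  swap
  · have hprm (t : Fin (T + 1)) := (hpr t).1
    exact fun d _ => Measurable.mul (by fun_prop)
      ((measurable_one.indicator hmeas).comp (measurable_withTreatments d))
  have hsimplex : ∀ᵐ z ∂Measure.pi (fun _ : Fin n => P), ∀ i,
      (fun t => pr t (z i).1) ∈ stdSimplex ℝ (Fin (T + 1)) :=
    ae_all_iff.2 fun i => (measurePreserving_eval (fun _ : Fin n => P) i).quasiMeasurePreserving.ae
      hpr.ae_mem_stdSimplex
  refine (lintegral_mono_ae (g := fun _ => ENNReal.ofReal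
    (√2 ^ (T * k) * Real.exp (-(n * ν ^ 2) / 2))) (hsimplex.mono fun z hz => ?_)).trans (by simp)
  have hpos (d : Fin n → Fin (T + 1)) : 0 ≤ ∏ i, pr (d i) (z i).1 :=
    Finset.prod_nonneg fun i _ => (hz i).1 (d i)
  refine le_trans (le_of_eq ?_) (ENNReal.ofReal_le_ofReal
    (sum_prod_mul_ite_lt_noise_le (fun i => x (z i).1) hz hν))
  rw [ENNReal.ofReal_sum_of_nonneg fun d _ => mul_nonneg (hpos d) (by split_ifs <;> norm_num)]
  refine Finset.sum_congr rfl fun d _ => ?_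
  rw [ENNReal.ofReal_mul (hpos d), ENNReal.ofReal_prod_of_nonneg fun i _ => (hz i).1 (d i),
    Set.indicator_apply, apply_ite ENNReal.ofReal, ENNReal.ofReal_one, ENNReal.ofReal_zero]
  rfl

end NoiseProbability

section NoiseLevel

lemma nat_mul_penalty_sq {n p T : ℕ} (hn : 0 < n) (hT : 0 < T) (X δD : ℝ) :
    n * penalty n p T X δD ^ 2 =
      4 * X ^ 2 * (T + √T * Real.log (max p n : ℕ) ^ (3 / 2 + δD)) := by
  have hr : 0 ≤ Real.log (max p n : ℕ) ^ (3 / 2 + δD) :=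
    Real.rpow_nonneg (Real.log_natCast_nonneg _) _
  unfold penalty
  set r := Real.log (max p n : ℕ) ^ (3 / 2 + δD)
  have hfactor : (T : ℝ) * (1 + r / √T) = T + √T * r := by
    rw [mul_add, mul_one, mul_div_left_comm, Real.div_sqrt, mul_comm r]
  rw [mul_pow, div_pow, mul_pow, Real.sq_sqrt n.cast_nonneg, Real.sq_sqrt T.cast_nonneg,
    Real.sq_sqrt (by positivity), ← hfactor]
  field_simp
  ring

lemma penalty_pos {n p T : ℕ} (hn : 0 < n) (hT : 0 < T) {X : ℝ} (hX : 0 < X) (δD : ℝ) :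
    0 < penalty n p T X δD := by
  unfold penalty
  positivity

lemma nat_mul_noiseLevel_sq {n p T : ℕ} (hn : 0 < n) (hT : 0 < T) (s : ℕ) {X : ℝ} (hX : X ≠ 0)
    (δD : ℝ) :
    n * (3 / 4 * penalty n p T X δD * √s / X) ^ 2 =
      9 / 4 * s * (T + √T * Real.log (max p n : ℕ) ^ (3 / 2 + δD)) := by
  calc n * (3 / 4 * penalty n p T X δD * √s / X) ^ 2
      = 9 / 16 * s * (n * penalty n p T X δD ^ 2) / X ^ 2 := by
        rw [div_pow, mul_pow, mul_pow, Real.sq_sqrt s.cast_nonneg]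
        ring
    _ = 9 / 4 * s * (T + √T * Real.log (max p n : ℕ) ^ (3 / 2 + δD)) := by
        rw [nat_mul_penalty_sq hn hT]
        field_simp
        ring

lemma sqrt_two_pow_two_mul_le_exp (m : ℕ) : √2 ^ (2 * m) ≤ Real.exp m := by
  rw [pow_mul, Real.sq_sqrt zero_le_two, ← Real.exp_one_pow]
  exact pow_le_pow_left₀ zero_le_two (by linarith [Real.add_one_le_exp (1 : ℝ)]) m

lemma sqrt_two_pow_mul_exp_noiseLevel_le {n p T : ℕ} (hn : 0 < n) (hT : 0 < T) (s : ℕ) {X : ℝ}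
    (hX : X ≠ 0) (δD : ℝ) :
    √2 ^ (T * (2 * s)) * Real.exp (-(n * (3 / 4 * penalty n p T X δD * √s / X) ^ 2) / 2) ≤
      Real.exp (-(s * Real.log (max p n : ℕ) ^ (3 / 2 + δD))) := by
  have hr : 0 ≤ Real.log (max p n : ℕ) ^ (3 / 2 + δD) :=
    Real.rpow_nonneg (Real.log_natCast_nonneg _) _
  rw [nat_mul_noiseLevel_sq hn hT s hX, mul_left_comm T 2 s]
  set r := Real.log (max p n : ℕ) ^ (3 / 2 + δD)
  refine (mul_le_mul_of_nonneg_right (sqrt_two_pow_two_mul_le_exp _) (Real.exp_pos _).le).trans ?_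
  rw [← Real.exp_add, Real.exp_le_exp, Nat.cast_mul]
  have hrT : s * r ≤ s * (√T * r) := mul_le_mul_of_nonneg_left
    (le_mul_of_one_le_left hr (Real.one_le_sqrt.2 (by exact_mod_cast hT))) s.cast_nonneg
  have hsT : 0 ≤ (s : ℝ) * T := by positivity
  have hsr : 0 ≤ (s : ℝ) * r := by positivity
  linarith

lemma min_one_pow_mul_exp_le_div {a r N : ℝ} {s : ℕ} (ha : 0 < a) (hs : s ≠ 0) (hr : 0 < r)
    (hN : 2 ≤ N) (haN : 4 * Real.log a ≤ N) :
    min 1 (a ^ (2 * s) * Real.exp (-(s * r))) ≤ N / r := by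
  rcases le_or_gt r N with hrN | hNr
  · exact (min_le_left _ _).trans ((one_le_div hr).2 hrN)
  have hexp : a ^ (2 * s) * Real.exp (-(s * r)) = Real.exp (2 * Real.log a - r) ^ s := by
    rw [pow_mul, ← mul_neg, Real.exp_nat_mul, ← mul_pow, sub_eq_add_neg, Real.exp_add,
      two_mul, Real.exp_add, Real.exp_log ha, sq]
  calc min 1 (a ^ (2 * s) * Real.exp (-(s * r)))
      ≤ Real.exp (2 * Real.log a - r) ^ s := hexp ▸ min_le_right _ _
    _ ≤ Real.exp (2 * Real.log a - r) :=
        pow_le_of_le_one (Real.exp_pos _).le (Real.exp_le_one_iff.2 (by linarith)) hs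
    _ ≤ Real.exp (-(r / 2)) := Real.exp_le_exp.2 (by linarith)
    _ ≤ (r / 2)⁻¹ := by
        rw [Real.exp_neg]
        exact inv_anti₀ (by positivity) (by linarith [Real.add_one_le_exp (r / 2)])
    _ ≤ N / r := by
        rw [inv_div]
        gcongr

lemma sixteen_mul_log_le {p : ℕ} (hp : 0 < p) :
    16 * Real.log (12 * p) ≤ 4 * √(Real.log (2 * p) * (1 + 64 * Real.log (12 * p) ^ 2)) := by
  have hp1 : (1 : ℝ) ≤ p := by exact_mod_cast hp
  have hlog : 1 / 4 ≤ Real.log (2 * p) := by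
    have hmono : Real.log 2 ≤ Real.log (2 * p) := Real.log_le_log two_pos (by linarith)
    linarith [Real.log_two_gt_d9]
  have hsqrt : 4 * Real.log (12 * p) ≤
      √(Real.log (2 * p) * (1 + 64 * Real.log (12 * p) ^ 2)) := by
    refine Real.le_sqrt_of_sq_le ?_
    nlinarith [mul_le_mul_of_nonneg_right hlog
      (by positivity : 0 ≤ 1 + 64 * Real.log (12 * p) ^ 2)]
  linarith

lemma min_one_pow_mul_exp_le_excProb {n p s : ℕ} (hp : 0 < p) (hs : s ≠ 0)
    (hpn : 1 < max p n) (δD : ℝ) :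
    min 1 ((p : ℝ) ^ (2 * s) * Real.exp (-(s * Real.log (max p n : ℕ) ^ (3 / 2 + δD)))) ≤
      excProb n p δD := by
  have hp0 : (0 : ℝ) < p := Nat.cast_pos.2 hp
  have hp1 : (1 : ℝ) ≤ p := by exact_mod_cast hp
  have hlog : 1 ≤ Real.log (12 * p) := by
    rw [Real.le_log_iff_exp_le (by positivity)]
    linarith [Real.exp_one_lt_d9]
  have hlogp : Real.log p ≤ Real.log (12 * p) := Real.log_le_log hp0 (by linarith)
  exact min_one_pow_mul_exp_le_div hp0 hs
    (Real.rpow_pos_of_pos (Real.log_pos (Nat.one_lt_cast.2 hpn)) _)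
    (by linarith [sixteen_mul_log_le hp]) (by linarith [sixteen_mul_log_le hp])

end NoiseLevel

section Sampling

variable {Ω E : Type*} [MeasurableSpace Ω] [MeasurableSpace E] {n p T : ℕ}
  {P : Measure (E × Fin (T + 1))} {pr : Fin (T + 1) → E → ℝ} {xs : E → Fin p → ℝ}
  {μ : Measure Ω} {Z : Fin n → Ω → E × Fin (T + 1)}

lemma measure_not_noiseBound_le [IsProbabilityMeasure P] [IsProbabilityMeasure μ]
    (hpr : IsPropensityScore P pr) (hxs : Measurable xs) (hZ : ∀ i, Measurable (Z i))
    (hindep : iIndepFun Z μ) (hlaw : ∀ i, μ.map (Z i) = P) (k : ℕ) {ν : ℝ} (hν : 0 ≤ ν) :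
    μ {ω | ¬ NoiseBound (fun i => xs (Z i ω).1) (fun i => (Z i ω).2)
        (fun i t => pr t (Z i ω).1) k ν} ≤
      ENNReal.ofReal (p ^ k * (√2 ^ (T * k) * Real.exp (-(n * ν ^ 2) / 2))) := by
  let bad (f : Fin k → Fin p) : Set (Fin n → E × Fin (T + 1)) :=
    largeNoise n (fun e l => xs e (f l)) pr ν
  have hxf (f : Fin k → Fin p) : Measurable fun e l => xs e (f l) := by fun_prop
  have hpi : μ.map (fun ω i => Z i ω) = Measure.pi fun _ : Fin n => P := by
    rw [(iIndepFun_iff_map_fun_eq_pi_map fun i => (hZ i).aemeasurable).1 hindep]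
    simp_rw [hlaw]
  have hbad (f : Fin k → Fin p) : μ ((fun ω i => Z i ω) ⁻¹' bad f) ≤
      ENNReal.ofReal (√2 ^ (T * k) * Real.exp (-(n * ν ^ 2) / 2)) := by
    rw [← Measure.map_apply (measurable_pi_lambda _ hZ)
      (measurableSet_largeNoise (hxf f) (fun t => (hpr t).1) ν), hpi]
    exact measure_largeNoise_le (hxf f) hpr hν
  calc μ _ ≤ μ (⋃ f, (fun ω i => Z i ω) ⁻¹' bad f) := by
        refine measure_mono fun ω hω => ?_
        contrapose! hω
        refine not_not.2 (noiseBound_of_forall fun f δ => ?_)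
        by_contra! hlt
        exact hω (Set.mem_iUnion.2 ⟨f, δ, hlt⟩)
    _ ≤ ∑ f, μ ((fun ω i => Z i ω) ⁻¹' bad f) := measure_iUnion_fintype_le _ _
    _ ≤ ∑ _f : Fin k → Fin p,
          ENNReal.ofReal (√2 ^ (T * k) * Real.exp (-(n * ν ^ 2) / 2)) :=
        Finset.sum_le_sum fun f _ => hbad f
    _ = ENNReal.ofReal (p ^ k * (√2 ^ (T * k) * Real.exp (-(n * ν ^ 2) / 2))) := by
        rw [Finset.sum_const, Finset.card_univ, Fintype.card_fun, Fintype.card_fin,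
          Fintype.card_fin, nsmul_eq_mul, ← ENNReal.ofReal_natCast,
          ← ENNReal.ofReal_mul (Nat.cast_nonneg _), Nat.cast_pow]

lemma ae_refitBounds_of_noiseBound [IsFiniteMeasure P] (hn : 0 < n) (hT : 0 < T)
    (hpr : IsPropensityScore P pr) {pmin : ℝ} (hoverlap : ∀ᵐ z ∂P, ∀ t, pmin ≤ pr t z.1)
    {X : ℝ} (hX : ∀ᵐ z ∂P, ∀ j, |xs z.1 j| ≤ X) (hZ : ∀ i, Measurable (Z i))
    (hlaw : ∀ i, μ.map (Z i) = P) {lam : ℝ} (hlam : 0 < X → 0 < lam) (γs : Coef T p)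
    (b κ A : Ω → ℝ) (Shat : Ω → Finset (Fin p)) (γt γh : Ω → Coef T p) :
    ∀ᵐ ω ∂μ, ((groupSupport γs).Nonempty → 0 < X →
        NoiseBound (fun i => xs (Z i ω).1) (fun i => (Z i ω).2) (fun i t => pr t (Z i ω).1)
          (2 * (groupSupport γs).card) (3 / 4 * lam * √(groupSupport γs).card / X)) →
      RefitBounds (fun i => xs (Z i ω).1) (fun i => (Z i ω).2) (fun i t => pr t (Z i ω).1) γs
        X lam pmin (b ω) (κ ω) (A ω) (Shat ω) (γt ω) (γh ω) := by
  have hsample : ∀ᵐ ω ∂μ, ∀ i, (∀ t, pmin ≤ pr t (Z i ω).1) ∧ (∀ j, |xs (Z i ω).1 j| ≤ X) ∧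
      ∑ t, pr t (Z i ω).1 = 1 := ae_all_iff.2 fun i =>
    ae_of_ae_map (p := fun z => (∀ t, pmin ≤ pr t z.1) ∧ (∀ j, |xs z.1 j| ≤ X) ∧
      ∑ t, pr t z.1 = 1) (hZ i).aemeasurable
      ((hlaw i).symm ▸ hoverlap.and (hX.and hpr.ae_sum_eq_one))
  filter_upwards [hsample] with ω hω
  exact refitBounds_of_noiseBound hn hT (fun i => (hω i).2.1) hlam (fun i => (hω i).1)
    fun i => (hω i).2.2

end Sampling

end PostMLogit

end

theorem mainTheorem8_general {Ω E : Type*} [MeasurableSpace Ω] [MeasurableSpace E]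
    (n p T : ℕ) (hn : 0 < n) (hT : 1 ≤ T)
    (P : Measure (E × Fin (T + 1))) [IsProbabilityMeasure P]
    (pr : Fin (T + 1) → E → ℝ) (hpr : PostMLogit.IsPropensityScore P pr)
    (pmin : ℝ) (hoverlap : ∀ᵐ z ∂P, ∀ t, pmin ≤ pr t z.1)
    (xs : E → Fin p → ℝ) (hxs : Measurable xs)
    (X : ℝ) (hX : ∀ᵐ z ∂P, ∀ j, |xs z.1 j| ≤ X)
    (μ : Measure Ω) [IsProbabilityMeasure μ]
    (Z : Fin n → Ω → E × Fin (T + 1)) (hZ : ∀ i, Measurable (Z i))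
    (hindep : iIndepFun Z μ) (hlaw : ∀ i, μ.map (Z i) = P)
    (γs : PostMLogit.Coef T p) (δD : ℝ)
    (hpn : (PostMLogit.groupSupport γs).Nonempty → 1 < max p n)
    (b κ A : Ω → ℝ) (Shat : Ω → Finset (Fin p)) (γt γh : Ω → PostMLogit.Coef T p) :
    μ {ω | ¬ PostMLogit.RefitBounds
        (fun i => xs (Z i ω).1) (fun i => (Z i ω).2) (fun i t => pr t (Z i ω).1) γs
        X (PostMLogit.penalty n p T X δD) pmin (b ω) (κ ω) (A ω) (Shat ω) (γt ω) (γh ω)} ≤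
      ENNReal.ofReal (PostMLogit.excProb n p δD) := by
  open PostMLogit in
  let s := (groupSupport γs).card
  have hdet := ae_refitBounds_of_noiseBound hn hT hpr hoverlap hX hZ hlaw
    (fun hX0 => penalty_pos (p := p) hn hT hX0 δD) γs b κ A Shat γt γh
  by_cases hdeg : (groupSupport γs).Nonempty ∧ 0 < X
  · obtain ⟨hS, hX0⟩ := hdeg
    have hp : 0 < p := hS.elim fun j _ => j.pos
    have hnoise := measure_not_noiseBound_le hpr hxs hZ hindep hlaw (2 * s)
      (ν := 3 / 4 * penalty n p T X δD * √s / X)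
      (by have := (penalty_pos (p := p) hn hT hX0 δD).le; positivity)
    calc μ _ ≤ min 1 (ENNReal.ofReal (p ^ (2 * s) * (√2 ^ (T * (2 * s)) *
            Real.exp (-(n * (3 / 4 * penalty n p T X δD * √s / X) ^ 2) / 2)))) :=
          le_min prob_le_one ((measure_mono_ae (hdet.mono fun ω hω =>
            mt fun hν => hω fun _ _ => hν)).trans hnoise)
      _ ≤ ENNReal.ofReal (min 1 (p ^ (2 * s) *
            Real.exp (-(s * Real.log (max p n : ℕ) ^ (3 / 2 + δD))))) := by
          rw [ENNReal.ofReal_min, ENNReal.ofReal_one]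
          gcongr
          exact sqrt_two_pow_mul_exp_noiseLevel_le hn hT s hX0.ne' δD
      _ ≤ ENNReal.ofReal (excProb n p δD) := ENNReal.ofReal_le_ofReal
          (min_one_pow_mul_exp_le_excProb hp hS.card_ne_zero (hpn hS) δD)
  · refine (ae_iff.1 (hdet.mono fun ω hω => hω fun hS hX0 => ?_)).trans_le zero_le
    exact (hdeg ⟨hS, hX0⟩).elim

theorem mainTheorem8 {Ω E : Type*} [MeasurableSpace Ω] [MeasurableSpace E]
    (n p T : ℕ) (hT : 1 ≤ T)
    -- the law of the raw covariates and the treatment, and the propensity scores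
    (P : Measure (E × Fin (T + 1))) [IsProbabilityMeasure P]
    (pr : Fin (T + 1) → E → ℝ) (hpr : PostMLogit.IsPropensityScore P pr)
    (pmin : ℝ) (hpmin : 0 < pmin) (hoverlap : ∀ᵐ z ∂P, ∀ t, pmin ≤ pr t z.1)
    -- the transformed covariates, bounded by `X`
    (xs : E → Fin p → ℝ) (hxs : Measurable xs)
    (X : ℝ) (hX : ∀ᵐ z ∂P, ∀ j, |xs z.1 j| ≤ X)
    -- the sample
    (μ : Measure Ω) [IsProbabilityMeasure μ]
    (Z : Fin n → Ω → E × Fin (T + 1)) (hZ : ∀ i, Measurable (Z i))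
    (hindep : iIndepFun Z μ) (hlaw : ∀ i, μ.map (Z i) = P)
    -- the sparse coefficients and the constant in the penalty
    (γs : PostMLogit.Coef T p) (hs : (PostMLogit.groupSupport γs).card < n)
    (δD : ℝ) (hδD : 0 < δD)
    -- sample-dependent bounds and constants, selected set, group lasso estimate and refit
    (b κ A : Ω → ℝ) (Shat : Ω → Finset (Fin p)) (γt γh : Ω → PostMLogit.Coef T p) :
    μ {ω | ¬ PostMLogit.RefitBounds
        (fun i => xs (Z i ω).1) (fun i => (Z i ω).2) (fun i t => pr t (Z i ω).1) γs
        X (PostMLogit.penalty n p T X δD) pmin (b ω) (κ ω) (A ω) (Shat ω) (γt ω) (γh ω)} ≤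
      ENNReal.ofReal (PostMLogit.excProb n p δD) := by
  exact mainTheorem8_general n p T (Nat.zero_lt_of_lt hs) hT P pr hpr pmin hoverlap xs hxs X hX
    μ Z hZ hindep hlaw γs δD
    (fun hS => lt_max_of_lt_right ((Nat.succ_le_of_lt hS.card_pos).trans_lt hs)) b κ A Shat γt γh
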